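/- Let $n,K\ge 1$, let $P\in[0,1]^{K\times K}$ be symmetric and $z\in[K]^n$. In the stochastic block model (SBM) with labels $z$ and connectivity matrix $P$, the adjacency matrix $A\in\{0,1\}^{n\times n}$ is symmetric with $A_{ii}=0$, and its entries $A_{ij}\sim\mathrm{Bern}(P_{z_iz_j})$, $i>j$, are independent. Write $p_{aj}:=P_{az_j}$, $p_{a*}:=(p_{a1},\dots,p_{an})$, $n_a:=|\{j: z_j=a\}|$ and $p^*:=\max_{a,b}P_{ab}$. For vectors $p,q$ with entries in $[0,1]$, let $\varphi_p$ denote the probability mass function of $\bigotimes_j\mathrm{Bern}(p_j)$, and let $$\eta(p,q)=\sum_x\min(\varphi_p(x),\varphi_q(x)),\qquad D^*(p,q)=\sup_{\alpha\in(0,1)}\Big(-\log\sum_x\varphi_p(x)^{1-\alpha}\varphi_q(x)^{\alpha}\Big)$$ be the total variation affinity and the Chernoff information. Fix a node $i$ and two labels $k\ne\ell$ with $z_i\in\{k,\ell\}$. Suppose that $P$ and all labels except $z_i$ are known and that the label of node $i$ is $k$ or $\ell$ with probability $\tfrac12$ each. Let $\hat z_i=\hat z_i(A)$ be a Bayes (maximum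 likelihood) estimator, $$\hat z_i\in\arg\max_{a\in\{k,\ell\}}\sum_{j\ne i}A_{ij}\log p_{aj}+(1-A_{ij})\log(1-p_{aj}),$$ with ties broken arbitrarily, $\log 0=-\infty$ and $0\cdot(-\infty)=0$. Let $\mathbb P(\hat z_i\ne z_i)$ be its error probability under this uniform prior on the label of node $i$. In the definition of $p_{a*}$ and $n_a$, $z_i$ may be either of the two candidate values. (a) $\mathbb P(\hat z_i\ne z_i)=\tfrac12\,\eta\big((p_{kj})_{j\ne i},(p_{\ell j})_{j\ne i}\big)$. Moreover, if $p^*\le 1-\varepsilon$ with $\varepsilon>0$, then $$\tfrac12\,\eta(p_{k*},p_{\ell*})\le\mathbb P(\hat z_i\ne z_i)\le\tfrac{1}{2\varepsilon}\,\eta(p_{k*},p_{\ell*}).$$ (b) Let $\beta>1$, $\varepsilon\in(0,1)$, $\omega>1$ and $K^*\in\mathbb N$. There are constants $C_1,C_2,c_1,c_2>0$ that depend only on $\beta,\varepsilon,\omega,K^*$ such that the following holds for all $n,K,P,z,i,k,\ell,\hat z_i$ as above with $K\le K^*$. Suppose that $$\frac{n}{\beta K}\le n_a\le\frac{\beta n}{K}\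 \ (a\in[K]),\qquad p^*\le 1-\varepsilon,\qquad \min_{a,b}P_{ab}>0,\qquad \frac{\max_{a,b}P_{ab}}{\min_{a,b}P_{ab}}\le\omega .$$ If $C_1\le np^*\le C_2\,D^*(p_{k*},p_{\ell*})^2$, then $$c_1R\le\mathbb P(\hat z_i\ne z_i)\le c_2R,\qquad R:=\Big(\sqrt{np^*}\,\max_{j\in[n]}\Big|\log\frac{p_{kj}(1-p_{\ell j})}{p_{\ell j}(1-p_{kj})}\Big|\Big)^{-1}\exp\big(-D^*(p_{k*},p_{\ell*})\big).$$ -/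

import Mathlib

noncomputable section

/-- Total variation affinity `∫ min(φ₀, φ₁) dμ` of two mass functions on a finite set, with
respect to the counting measure. -/
def tvAffinity {Ω : Type*} [Fintype Ω] (φ₀ φ₁ : Ω → ℝ) : ℝ :=
  ∑ x, min (φ₀ x) (φ₁ x)

/-- Chernoff `α`-divergence `-log ∫ φ₀^(1-α) φ₁^α dμ`. -/
def chernoffDiv {Ω : Type*} [Fintype Ω] (α : ℝ) (φ₀ φ₁ : Ω → ℝ) : ℝ :=
  -Real.log (∑ x, φ₀ x ^ (1 - α) * φ₁ x ^ α)

/-- Chernoff information: the supremum over `α ∈ (0,1)` of the Chernoff `α`-divergence. -/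
def chernoffInfo {Ω : Type*} [Fintype Ω] (φ₀ φ₁ : Ω → ℝ) : ℝ :=
  ⨆ α : Set.Ioo (0 : ℝ) 1, chernoffDiv (α : ℝ) φ₀ φ₁

/-- Mass function of `⨂ⱼ Bern(pⱼ)`: independent coordinates, the `j`-th one being `true` (that is,
`1`) with probability `p j`. -/
def bernPMF {ι : Type*} [Fintype ι] (p : ι → ℝ) (x : ι → Bool) : ℝ :=
  ∏ j, if x j then p j else 1 - p j

/-- The vector `p_{a*} = (P_{a z_1}, …, P_{a z_n})`. -/
def paramVec {n K : ℕ} (P : Matrix (Fin K) (Fin K) ℝ) (z : Fin n → Fin K) (a : Fin K) :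
    Fin n → ℝ :=
  fun j => P a (z j)

/-- The same vector without its `i`-th entry. -/
def paramVecErase {n K : ℕ} (P : Matrix (Fin K) (Fin K) ℝ) (z : Fin n → Fin K) (i : Fin n)
    (a : Fin K) : {j : Fin n // j ≠ i} → ℝ :=
  fun j => P a (z j)

/-- Unordered pairs of distinct nodes, written as `(i, j)` with `j < i`. -/
abbrev NodePair (n : ℕ) : Type := {e : Fin n × Fin n // e.2 < e.1}

/-- The adjacency matrix with `A i j = A j i = w (i, j)` for `j < i` and zero diagonal. -/
def adjOfPairs {n : ℕ} (w : NodePair n → Bool) : Matrix (Fin n) (Fin n) Bool :=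
  fun i j => if h : j < i then w ⟨(i, j), h⟩ else if h : i < j then w ⟨(j, i), h⟩ else false

/-- Probability of the event `S` for the adjacency matrix of the stochastic block model with labels
`z` and connectivity matrix `P`: the entries below the diagonal are independent,
`A i j ∼ Bern(P_{z_i z_j})`. -/
def sbmProb {n K : ℕ} (P : Matrix (Fin K) (Fin K) ℝ) (z : Fin n → Fin K)
    (S : Set (Matrix (Fin n) (Fin n) Bool)) : ℝ :=
  ∑ w : NodePair n → Bool,
    bernPMF (fun e : NodePair n => P (z e.1.1) (z e.1.2)) w *
      S.indicator (fun _ => (1 : ℝ)) (adjOfPairs w)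

/-- Log-likelihood of label `a` for node `i`,
`∑_{j ≠ i} A_{ij} log p_{aj} + (1 - A_{ij}) log (1 - p_{aj})`, valued in the extended reals with
`log 0 = -∞` and `0 · (-∞) = 0`. -/
def nodeLogLik {n K : ℕ} (P : Matrix (Fin K) (Fin K) ℝ) (z : Fin n → Fin K) (i : Fin n)
    (A : Matrix (Fin n) (Fin n) Bool) (a : Fin K) : EReal :=
  ∑ j ∈ Finset.univ.erase i,
    if A i j then ENNReal.log (ENNReal.ofReal (P a (z j)))
    else ENNReal.log (ENNReal.ofReal (1 - P a (z j)))

/-- `zhat` is a Bayes (maximum likelihood) estimator of the label of node `i` between the two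
candidates `k` and `l`; ties may be broken in any way. -/
def IsBayesEstimator {n K : ℕ} (P : Matrix (Fin K) (Fin K) ℝ) (z : Fin n → Fin K) (i : Fin n)
    (k l : Fin K) (zhat : Matrix (Fin n) (Fin n) Bool → Fin K) : Prop :=
  ∀ A, (zhat A = k ∨ zhat A = l) ∧
    ∀ a, a = k ∨ a = l → nodeLogLik P z i A a ≤ nodeLogLik P z i A (zhat A)

/-- Error probability `ℙ(zhat(A) ≠ z_i)` when `z_i` is `k` or `l` with probability `1/2` each, the
other labels are those of `z`, and `A` is drawn from the block model given all the labels. -/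
def labelError {n K : ℕ} (P : Matrix (Fin K) (Fin K) ℝ) (z : Fin n → Fin K) (i : Fin n)
    (k l : Fin K) (zhat : Matrix (Fin n) (Fin n) Bool → Fin K) : ℝ :=
  (1 / 2) * sbmProb P (Function.update z i k) {A | zhat A ≠ k} +
    (1 / 2) * sbmProb P (Function.update z i l) {A | zhat A ≠ l}

/-- The largest entry `p^*` of `P`. -/
def maxEntry {K : ℕ} (P : Matrix (Fin K) (Fin K) ℝ) : ℝ :=
  ⨆ e : Fin K × Fin K, P e.1 e.2

/-- The smallest entry of `P`. -/
def minEntry {K : ℕ} (P : Matrix (Fin K) (Fin K) ℝ) : ℝ :=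
  ⨅ e : Fin K × Fin K, P e.1 e.2

/-- Number of nodes with label `a`. -/
def classSize {n K : ℕ} (z : Fin n → Fin K) (a : Fin K) : ℕ :=
  (Finset.univ.filter fun j => z j = a).card

/-- Balanced communities, `p^* ≤ 1 - ε`, and entries of `P` comparable up to the factor `ω`. -/
structure BlockRegular {n K : ℕ} (β ε ω : ℝ) (P : Matrix (Fin K) (Fin K) ℝ)
    (z : Fin n → Fin K) : Prop where
  size_lower : ∀ a, (n : ℝ) / (β * K) ≤ classSize z a
  size_upper : ∀ a, (classSize z a : ℝ) ≤ β * n / K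
  max_le : maxEntry P ≤ 1 - ε
  min_pos : 0 < minEntry P
  ratio_le : maxEntry P / minEntry P ≤ ω

/-- `max_j |log (p_j (1 - q_j) / (q_j (1 - p_j)))|`. -/
def maxLogOdds {n : ℕ} (p q : Fin n → ℝ) : ℝ :=
  ⨆ j, |Real.log (p j * (1 - q j) / (q j * (1 - p j)))|

/-- `(√(n p^*) · max_j |log-odds ratio|)⁻¹ · exp(-D^*(p_{k*}, p_{l*}))`. -/
def errorRate {n K : ℕ} (P : Matrix (Fin K) (Fin K) ℝ) (z : Fin n → Fin K) (k l : Fin K) : ℝ :=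
  (Real.sqrt (n * maxEntry P) * maxLogOdds (paramVec P z k) (paramVec P z l))⁻¹ *
    Real.exp (-chernoffInfo (bernPMF (paramVec P z k)) (bernPMF (paramVec P z l)))

end

noncomputable section

open Finset Real

/-!
Conditionally on the other edges the row of node `i` is a product Bernoulli vector, so the Bayes
error is half an affinity `∑ min(φ_p, φ_q)`, and one coordinate with parameters at most `1 - ε`
changes an affinity by a factor in `[ε, 1]`.

For the rate, let `a` be the critical point of the convex function
`a ↦ log ∑ φ_p ^ (1 - a) φ_q ^ a`, whose value there is `-D^*`. The law proportional to
`φ_p ^ (1 - a) φ_q ^ a` is again product Bernoulli, and under it the log-likelihood ratio `L` is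
centred. Comparability of the parameters keeps `a` away from `0` and `1`, so that
`exp (-D^*) 𝔼 exp (-|L|) ≤ ∑ min(φ_p, φ_q) ≤ exp (-D^*) 𝔼 exp (-κ |L|)`. Both expectations are of
order `1 / (s |λ|)`, where `λ` is the largest log-odds ratio: the coordinates with the parameter
pair attaining `λ` contribute to `L` the multiple `λ` of a centred binomial variable of standard
deviation `s ≍ √(n p^*)`, whose atoms have mass at most of order `1 / s`, and at least of that order
within a bounded number of standard deviations of the mean.
-/

/-! ### Product Bernoulli mass functions -/

theorem sum_filter_abs_le_ge {Ω : Type*} (s : Finset Ω) {w f : Ω → ℝ} {T : ℝ}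
    (hw : ∀ x ∈ s, 0 ≤ w x) (hT : 0 < T) :
    ∑ x ∈ s, w x - (∑ x ∈ s, w x * f x ^ 2) / T ^ 2 ≤ ∑ x ∈ s with |f x| ≤ T, w x := by
  have htail : ∑ x ∈ s with ¬ |f x| ≤ T, w x ≤ (∑ x ∈ s, w x * f x ^ 2) / T ^ 2 := by
    rw [le_div_iff₀ (pow_pos hT 2), sum_mul]
    calc ∑ x ∈ s with ¬ |f x| ≤ T, w x * T ^ 2
        ≤ ∑ x ∈ s with ¬ |f x| ≤ T, w x * f x ^ 2 := by
          refine sum_le_sum fun x hx => ?_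
          rw [mem_filter, not_le] at hx
          exact mul_le_mul_of_nonneg_left (sq_le_sq.2 (by rw [abs_of_pos hT]; exact hx.2.le))
            (hw x hx.1)
      _ ≤ ∑ x ∈ s, w x * f x ^ 2 :=
          sum_le_sum_of_subset_of_nonneg (filter_subset _ _) fun x hx _ =>
            mul_nonneg (hw x hx) (sq_nonneg _)
  linarith [sum_filter_add_sum_filter_not s (fun x => |f x| ≤ T) w]

section BernPMF

variable {ι κ : Type*} [Fintype ι] [Fintype κ]

theorem bernPMF_nonneg {p : ι → ℝ} (hp : ∀ j, p j ∈ Set.Icc (0 : ℝ) 1) (x : ι → Bool) :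
    0 ≤ bernPMF p x := by
  refine prod_nonneg fun j _ => ?_
  split_ifs
  exacts [(hp j).1, sub_nonneg.2 (hp j).2]

theorem bernPMF_pos {p : ι → ℝ} (hp : ∀ j, p j ∈ Set.Ioo (0 : ℝ) 1) (x : ι → Bool) :
    0 < bernPMF p x := by
  refine prod_pos fun j _ => ?_
  split_ifs
  exacts [(hp j).1, sub_pos.2 (hp j).2]

theorem bernPMF_comp_equiv (e : κ ≃ ι) (p : ι → ℝ) (x : ι → Bool) :
    bernPMF (p ∘ e) (x ∘ e) = bernPMF p x :=
  e.prod_comp fun j => if x j then p j else 1 - p j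

theorem bernPMF_eq_mul (A : ι → Prop) [DecidablePred A] (p : ι → ℝ) (x : ι → Bool) :
    bernPMF p x = bernPMF (fun j : {j // A j} => p j) (fun j => x j) *
      bernPMF (fun j : {j // ¬ A j} => p j) (fun j => x j) :=
  (Fintype.prod_subtype_mul_prod_subtype A _).symm

variable [DecidableEq ι]

theorem sum_eq_sum_sum_restrict {M β : Type*} [AddCommMonoid M] [Fintype β] (A : ι → Prop)
    [DecidablePred A] (F : ({j // A j} → β) → ({j // ¬ A j} → β) → M) :
    ∑ x : ι → β, F (fun j => x j) (fun j => x j) = ∑ u, ∑ v, F u v := by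
  rw [← Fintype.sum_prod_type']
  exact Fintype.sum_equiv (Equiv.piEquivPiSubtypeProd A fun _ => β) _ _ fun _ => rfl

theorem sum_bernPMF_mul_prod (p : ι → ℝ) (g : ι → Bool → ℝ) :
    ∑ x, bernPMF p x * ∏ j, g j (x j) = ∏ j, (p j * g j true + (1 - p j) * g j false) := by
  have h := prod_univ_sum (fun _ : ι => (univ : Finset Bool))
    fun j b => (if b then p j else 1 - p j) * g j b
  simpa only [bernPMF, Fintype.piFinset_univ, Fintype.sum_bool, prod_mul_distrib, if_true,
    Bool.false_eq_true, if_false] using h.symm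

theorem sum_bernPMF (p : ι → ℝ) : ∑ x, bernPMF p x = 1 := by
  simpa using sum_bernPMF_mul_prod p fun _ _ => 1

theorem sum_bernPMF_mul_apply (p : ι → ℝ) (i : ι) (f : Bool → ℝ) :
    ∑ x, bernPMF p x * f (x i) = p i * f true + (1 - p i) * f false := by
  have h := sum_bernPMF_mul_prod p fun k b => if k = i then f b else 1
  have hfactor (k : ι) : p k * (if k = i then f true else 1) +
      (1 - p k) * (if k = i then f false else 1) =
      if k = i then p k * f true + (1 - p k) * f false else 1 := by
    split_ifs <;> ring
  simpa only [hfactor, Fintype.prod_ite_eq'] using h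

theorem sum_bernPMF_mul_apply_mul_apply (p : ι → ℝ) {i j : ι} (hij : i ≠ j) (f g : Bool → ℝ) :
    ∑ x, bernPMF p x * (f (x i) * g (x j)) =
      (p i * f true + (1 - p i) * f false) * (p j * g true + (1 - p j) * g false) := by
  have h := sum_bernPMF_mul_prod p fun k b =>
    (if k = i then f b else 1) * (if k = j then g b else 1)
  have hfactor (k : ι) : p k * ((if k = i then f true else 1) * (if k = j then g true else 1)) +
      (1 - p k) * ((if k = i then f false else 1) * (if k = j then g false else 1)) =
      (if k = i then p k * f true + (1 - p k) * f false else 1) *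
        (if k = j then p k * g true + (1 - p k) * g false else 1) := by
    split_ifs with hi hj
    · exact absurd (hi.symm.trans hj) hij
    all_goals ring
  simpa only [hfactor, prod_mul_distrib, Fintype.prod_ite_eq'] using h

/-- The weighted sum `∑ⱼ cⱼ (xⱼ - pⱼ)` of centred outcomes. Under the critical tilted law of
`p` and `q` it is the log-likelihood ratio, with `c` the log odds ratios. -/
def centredSum (p c : ι → ℝ) (x : ι → Bool) : ℝ :=
  ∑ j, c j * ((if x j then 1 else 0) - p j)

omit [DecidableEq ι] in
theorem centredSum_eq_add (A : ι → Prop) [DecidablePred A] (p c : ι → ℝ) (x : ι → Bool) :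
    centredSum p c x =
      centredSum (fun j : {j // A j} => p j) (fun j => c j) (fun j => x j) +
        centredSum (fun j : {j // ¬ A j} => p j) (fun j => c j) (fun j => x j) :=
  (Fintype.sum_subtype_add_sum_subtype A _).symm

theorem sum_bernPMF_mul_centredSum_sq (p c : ι → ℝ) :
    ∑ x, bernPMF p x * centredSum p c x ^ 2 = ∑ j, c j ^ 2 * (p j * (1 - p j)) := by
  have hcov (i j : ι) : ∑ x, bernPMF p x *
      ((c i * ((if x i then 1 else 0) - p i)) * (c j * ((if x j then 1 else 0) - p j))) =
      if i = j then c i ^ 2 * (p i * (1 - p i)) else 0 := by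
    split_ifs with hij
    · subst hij
      rw [sum_bernPMF_mul_apply p i fun b =>
        (c i * ((if b then 1 else 0) - p i)) * (c i * ((if b then 1 else 0) - p i))]
      simp only [if_true, Bool.false_eq_true, if_false]
      ring
    · rw [sum_bernPMF_mul_apply_mul_apply p hij (fun b => c i * ((if b then 1 else 0) - p i))
        fun b => c j * ((if b then 1 else 0) - p j)]
      simp only [if_true, Bool.false_eq_true, if_false]
      ring
  calc ∑ x, bernPMF p x * centredSum p c x ^ 2
      = ∑ i, ∑ j, ∑ x, bernPMF p x *
          ((c i * ((if x i then 1 else 0) - p i)) * (c j * ((if x j then 1 else 0) - p j))) := by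
        simp only [centredSum, sq, sum_mul_sum]
        simp only [mul_sum]
        rw [sum_comm]
        exact sum_congr rfl fun i _ => sum_comm
    _ = ∑ j, c j ^ 2 * (p j * (1 - p j)) := by simp [hcov]

theorem half_le_sum_bernPMF_abs_centredSum_le {p : ι → ℝ} (hp : ∀ j, p j ∈ Set.Icc (0 : ℝ) 1)
    (c : ι → ℝ) {T : ℝ} (hT : 0 < T) (h : 2 * ∑ j, c j ^ 2 * (p j * (1 - p j)) ≤ T ^ 2) :
    1 / 2 ≤ ∑ x with |centredSum p c x| ≤ T, bernPMF p x := by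
  refine le_trans ?_ (sum_filter_abs_le_ge univ (fun x _ => bernPMF_nonneg hp x) hT)
  rw [sum_bernPMF, sum_bernPMF_mul_centredSum_sq]
  have : (∑ j, c j ^ 2 * (p j * (1 - p j))) / T ^ 2 ≤ 1 / 2 := by
    rw [div_le_iff₀ (pow_pos hT 2)]
    linarith
  linarith

end BernPMF

/-! ### Total variation affinity of product measures -/

section Affinity

variable {ι κ : Type*} [Fintype ι] [Fintype κ] [DecidableEq ι] {p q : ι → ℝ}

theorem tvAffinity_bernPMF_self (p : ι → ℝ) : tvAffinity (bernPMF p) (bernPMF p) = 1 := by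
  simp only [tvAffinity, min_self, sum_bernPMF]

theorem tvAffinity_bernPMF_comp_equiv [DecidableEq κ] (e : κ ≃ ι) (p q : ι → ℝ) :
    tvAffinity (bernPMF (p ∘ e)) (bernPMF (q ∘ e)) = tvAffinity (bernPMF p) (bernPMF q) :=
  (Fintype.sum_equiv (e.arrowCongr (Equiv.refl Bool)).symm _ _ fun x => by
    simp only [← bernPMF_comp_equiv e _ x]; rfl).symm

theorem tvAffinity_bernPMF_le_restrict (A : ι → Prop) [DecidablePred A] (p q : ι → ℝ) :
    tvAffinity (bernPMF p) (bernPMF q) ≤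
      tvAffinity (bernPMF fun j : {j // A j} => p j) (bernPMF fun j : {j // A j} => q j) := by
  simp only [tvAffinity, bernPMF_eq_mul A]
  rw [sum_eq_sum_sum_restrict A fun u v =>
    min (bernPMF _ u * bernPMF (fun j : {j // ¬ A j} => p j) v) (bernPMF _ u * bernPMF _ v)]
  refine sum_le_sum fun u _ => (sum_min_le ..).trans_eq ?_
  simp only [← mul_sum, sum_bernPMF, mul_one]

theorem tvAffinity_restrict_mul_le (A : ι → Prop) [DecidablePred A]
    (hp : ∀ j, p j ∈ Set.Icc (0 : ℝ) 1) (hq : ∀ j, q j ∈ Set.Icc (0 : ℝ) 1) :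
    tvAffinity (bernPMF fun j : {j // A j} => p j) (bernPMF fun j : {j // A j} => q j) *
        tvAffinity (bernPMF fun j : {j // ¬ A j} => p j) (bernPMF fun j : {j // ¬ A j} => q j) ≤
      tvAffinity (bernPMF p) (bernPMF q) := by
  simp only [tvAffinity, bernPMF_eq_mul A p, bernPMF_eq_mul A q]
  rw [sum_eq_sum_sum_restrict A fun u v =>
    min (bernPMF _ u * bernPMF (fun j : {j // ¬ A j} => p j) v) (bernPMF _ u * bernPMF _ v),
    sum_mul_sum]
  refine sum_le_sum fun u _ => sum_le_sum fun v _ => ?_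
  have hpu := bernPMF_nonneg (fun j : {j // A j} => hp j) u
  have hqu := bernPMF_nonneg (fun j : {j // A j} => hq j) u
  have hpv := bernPMF_nonneg (fun j : {j // ¬ A j} => hp j) v
  have hqv := bernPMF_nonneg (fun j : {j // ¬ A j} => hq j) v
  exact le_min (mul_le_mul (min_le_left _ _) (min_le_left _ _) (le_min hpv hqv) hpu)
    (mul_le_mul (min_le_right _ _) (min_le_right _ _) (le_min hpv hqv) hqu)

theorem tvAffinity_bernPMF_eq_restrict (A : ι → Prop) [DecidablePred A]
    (hp : ∀ j, p j ∈ Set.Icc (0 : ℝ) 1) (hq : ∀ j, q j ∈ Set.Icc (0 : ℝ) 1)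
    (h : ∀ j, ¬ A j → p j = q j) :
    tvAffinity (bernPMF p) (bernPMF q) =
      tvAffinity (bernPMF fun j : {j // A j} => p j) (bernPMF fun j : {j // A j} => q j) := by
  refine (tvAffinity_bernPMF_le_restrict A p q).antisymm ?_
  have hmul := tvAffinity_restrict_mul_le A hp hq
  rwa [show (fun j : {j // ¬ A j} => p j) = fun j : {j // ¬ A j} => q j from
    funext fun j => h j j.2, tvAffinity_bernPMF_self, mul_one] at hmul

theorem min_one_sub_le_tvAffinity_bernPMF [DecidableEq κ] [Unique κ] {p q : κ → ℝ}
    (hp : ∀ j, p j ∈ Set.Icc (0 : ℝ) 1) (hq : ∀ j, q j ∈ Set.Icc (0 : ℝ) 1) :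
    min (1 - p default) (1 - q default) ≤ tvAffinity (bernPMF p) (bernPMF q) := by
  refine le_trans (by simp [bernPMF]) (single_le_sum (fun x _ => ?_) (mem_univ fun _ => false))
  exact le_min (bernPMF_nonneg hp x) (bernPMF_nonneg hq x)

theorem mul_tvAffinity_restrict_ne_le (hp : ∀ j, p j ∈ Set.Icc (0 : ℝ) 1)
    (hq : ∀ j, q j ∈ Set.Icc (0 : ℝ) 1) {i : ι} {ε : ℝ} (hpi : p i ≤ 1 - ε) (hqi : q i ≤ 1 - ε) :
    ε * tvAffinity (bernPMF fun j : {j // j ≠ i} => p j) (bernPMF fun j : {j // j ≠ i} => q j) ≤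
      tvAffinity (bernPMF p) (bernPMF q) := by
  let : Unique {j // ¬ j ≠ i} := ⟨⟨⟨i, not_not.2 rfl⟩⟩, fun j => Subtype.ext (not_not.1 j.2)⟩
  have hsingle := min_one_sub_le_tvAffinity_bernPMF (fun j : {j // ¬ j ≠ i} => hp j)
    (fun j : {j // ¬ j ≠ i} => hq j)
  have hε : ε ≤ min (1 - p i) (1 - q i) := le_min (by linarith) (by linarith)
  refine le_trans ?_ (tvAffinity_restrict_mul_le (· ≠ i) hp hq)
  rw [mul_comm]
  exact mul_le_mul_of_nonneg_left (hε.trans hsingle) (sum_nonneg fun x _ =>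
    le_min (bernPMF_nonneg (fun j => hp j.1) x) (bernPMF_nonneg (fun j => hq j.1) x))

end Affinity

/-! ### Bayes error in the block model -/

theorem log_prod_eq_sum_log {ι : Type*} (s : Finset ι) (f : ι → ENNReal) :
    ENNReal.log (∏ j ∈ s, f j) = ∑ j ∈ s, ENNReal.log (f j) := by
  classical
  induction s using Finset.induction_on with
  | empty => simp
  | insert a s ha ih => rw [prod_insert ha, sum_insert ha, ENNReal.log_mul_add, ih]

section Bayes

variable {n K : ℕ} {P : Matrix (Fin K) (Fin K) ℝ} {z : Fin n → Fin K} {i : Fin n} {k l : Fin K}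
  {zhat : Matrix (Fin n) (Fin n) Bool → Fin K}

/-- The connection probabilities of all pairs of nodes, as parameters of the law of the pairs. -/
def edgeVec (P : Matrix (Fin K) (Fin K) ℝ) (z : Fin n → Fin K) : NodePair n → ℝ :=
  fun e => P (z e.1.1) (z e.1.2)

/-- The pairs that contain node `i`, indexed by the other node: the row of `i` in the adjacency
matrix. -/
def incidentPairEquiv (i : Fin n) :
    {j : Fin n // j ≠ i} ≃ {e : NodePair n // e.1.1 = i ∨ e.1.2 = i} where
  toFun j :=
    if h : j.1 < i then ⟨⟨(i, j.1), h⟩, Or.inl rfl⟩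
    else ⟨⟨(j.1, i), (not_lt.1 h).lt_of_ne' j.2⟩, Or.inr rfl⟩
  invFun e :=
    if h : e.1.1.1 = i then ⟨e.1.1.2, fun h' => e.1.2.ne (h'.trans h.symm)⟩ else ⟨e.1.1.1, h⟩
  left_inv j := by
    by_cases h : j.1 < i
    · simp [h]
    · simp [h, j.2]
  right_inv := by
    rintro ⟨⟨⟨a, b⟩, hab⟩, rfl | rfl⟩
    · simp [show b < a from hab]
    · simp [(show b < a from hab).ne', (show b < a from hab).not_gt]

theorem adjOfPairs_apply_ne (w : NodePair n → Bool) (j : {j : Fin n // j ≠ i}) :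
    adjOfPairs w i j = w (incidentPairEquiv i j) := by
  by_cases h : j.1 < i
  · simp [adjOfPairs, incidentPairEquiv, h]
  · simp [adjOfPairs, incidentPairEquiv, h, (not_lt.1 h).lt_of_ne' j.2]

theorem edgeVec_update_comp_incidentPairEquiv (hP : P.IsSymm) (z : Fin n → Fin K) (i : Fin n)
    (a : Fin K) :
    (fun e : {e : NodePair n // e.1.1 = i ∨ e.1.2 = i} =>
      edgeVec P (Function.update z i a) e) ∘ incidentPairEquiv i = paramVecErase P z i a := by
  funext j
  by_cases h : j.1 < i
  · simp [edgeVec, incidentPairEquiv, h, paramVecErase, j.2]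
  · simp [edgeVec, incidentPairEquiv, h, paramVecErase, j.2, hP.apply]

theorem edgeVec_update_of_not_incident (P : Matrix (Fin K) (Fin K) ℝ) (z : Fin n → Fin K)
    (a : Fin K) {e : NodePair n} (he : ¬ (e.1.1 = i ∨ e.1.2 = i)) :
    edgeVec P (Function.update z i a) e = edgeVec P z e := by
  rw [not_or] at he
  simp [edgeVec, he.1, he.2]

theorem bernPMF_edgeVec_update (hP : P.IsSymm) (z : Fin n → Fin K) (i : Fin n) (a : Fin K)
    (w : NodePair n → Bool) :
    bernPMF (edgeVec P (Function.update z i a)) w =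
      bernPMF (paramVecErase P z i a) (fun j => adjOfPairs w i j) *
        bernPMF (fun e : {e : NodePair n // ¬ (e.1.1 = i ∨ e.1.2 = i)} => edgeVec P z e)
          (fun e => w e) := by
  rw [bernPMF_eq_mul (fun e : NodePair n => e.1.1 = i ∨ e.1.2 = i)]
  congr 1
  · rw [← bernPMF_comp_equiv (incidentPairEquiv i), edgeVec_update_comp_incidentPairEquiv hP]
    simp only [adjOfPairs_apply_ne]
    rfl
  · congr 1
    exact funext fun e => edgeVec_update_of_not_incident P z a e.2

theorem tvAffinity_edgeVec_update (hP : P.IsSymm) (h01 : ∀ a b, P a b ∈ Set.Icc (0 : ℝ) 1)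
    (z : Fin n → Fin K) (i : Fin n) (k l : Fin K) :
    tvAffinity (bernPMF (edgeVec P (Function.update z i k)))
        (bernPMF (edgeVec P (Function.update z i l))) =
      tvAffinity (bernPMF (paramVecErase P z i k)) (bernPMF (paramVecErase P z i l)) := by
  rw [tvAffinity_bernPMF_eq_restrict (p := edgeVec P (Function.update z i k))
      (q := edgeVec P (Function.update z i l)) (fun e => e.1.1 = i ∨ e.1.2 = i)
      (fun _ => h01 _ _) (fun _ => h01 _ _) fun e he => by
        simp only [edgeVec_update_of_not_incident P z _ he],
    ← tvAffinity_bernPMF_comp_equiv (incidentPairEquiv i)]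
  simp only [edgeVec_update_comp_incidentPairEquiv hP]

theorem nodeLogLik_eq_log_bernPMF (h01 : ∀ a b, P a b ∈ Set.Icc (0 : ℝ) 1) (z : Fin n → Fin K)
    (i : Fin n) (A : Matrix (Fin n) (Fin n) Bool) (a : Fin K) :
    nodeLogLik P z i A a =
      ENNReal.log (ENNReal.ofReal (bernPMF (paramVecErase P z i a) fun j => A i j)) := by
  rw [nodeLogLik, bernPMF, ENNReal.ofReal_prod_of_nonneg, log_prod_eq_sum_log,
    sum_subtype (p := fun j => j ≠ i) _ (by simp)]
  · refine sum_congr rfl fun j _ => ?_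
    split_ifs <;> rfl
  · intro j _
    split_ifs
    exacts [(h01 _ _).1, sub_nonneg.2 (h01 _ _).2]

theorem bernPMF_edgeVec_update_le_of_nodeLogLik_le (hP : P.IsSymm)
    (h01 : ∀ a b, P a b ∈ Set.Icc (0 : ℝ) 1) {w : NodePair n → Bool}
    (h : nodeLogLik P z i (adjOfPairs w) k ≤ nodeLogLik P z i (adjOfPairs w) l) :
    bernPMF (edgeVec P (Function.update z i k)) w ≤
      bernPMF (edgeVec P (Function.update z i l)) w := by
  rw [nodeLogLik_eq_log_bernPMF h01, nodeLogLik_eq_log_bernPMF h01, ENNReal.log_le_log_iff,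
    ENNReal.ofReal_le_ofReal_iff (bernPMF_nonneg (p := paramVecErase P z i l) (fun _ => h01 _ _) _)]
    at h
  rw [bernPMF_edgeVec_update hP, bernPMF_edgeVec_update hP]
  exact mul_le_mul_of_nonneg_right h (bernPMF_nonneg (fun _ => h01 _ _) _)

theorem labelError_eq_half_tvAffinity (hP : P.IsSymm) (h01 : ∀ a b, P a b ∈ Set.Icc (0 : ℝ) 1)
    (hkl : k ≠ l) (hz : IsBayesEstimator P z i k l zhat) :
    labelError P z i k l zhat =
      (1 / 2) * tvAffinity (bernPMF (paramVecErase P z i k)) (bernPMF (paramVecErase P z i l)) := by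
  rw [← tvAffinity_edgeVec_update hP h01, labelError, sbmProb, sbmProb, ← mul_add,
    ← sum_add_distrib, tvAffinity]
  congr 1
  refine sum_congr rfl fun w _ => ?_
  obtain ⟨hchoice, hbest⟩ := hz (adjOfPairs w)
  change bernPMF (edgeVec P (Function.update z i k)) w * _ +
    bernPMF (edgeVec P (Function.update z i l)) w * _ = _
  rcases hchoice with hk | hl
  · have hle := bernPMF_edgeVec_update_le_of_nodeLogLik_le hP h01 (hk ▸ hbest l (Or.inr rfl))
    simp [hk, hkl, min_eq_right hle]
  · have hle := bernPMF_edgeVec_update_le_of_nodeLogLik_le hP h01 (hl ▸ hbest k (Or.inl rfl))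
    simp [hl, hkl.symm, min_eq_left hle]

theorem half_tvAffinity_paramVec_le_labelError (hP : P.IsSymm)
    (h01 : ∀ a b, P a b ∈ Set.Icc (0 : ℝ) 1) (hkl : k ≠ l)
    (hz : IsBayesEstimator P z i k l zhat) :
    (1 / 2) * tvAffinity (bernPMF (paramVec P z k)) (bernPMF (paramVec P z l)) ≤
      labelError P z i k l zhat := by
  rw [labelError_eq_half_tvAffinity hP h01 hkl hz]
  exact mul_le_mul_of_nonneg_left (tvAffinity_bernPMF_le_restrict (· ≠ i) _ _) (by norm_num)

theorem le_maxEntry (P : Matrix (Fin K) (Fin K) ℝ) (a b : Fin K) : P a b ≤ maxEntry P :=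
  le_ciSup (f := fun e : Fin K × Fin K => P e.1 e.2) (Set.finite_range _).bddAbove (a, b)

theorem minEntry_le (P : Matrix (Fin K) (Fin K) ℝ) (a b : Fin K) : minEntry P ≤ P a b :=
  ciInf_le (f := fun e : Fin K × Fin K => P e.1 e.2) (Set.finite_range _).bddBelow (a, b)

theorem labelError_le_inv_mul_half_tvAffinity_paramVec (hP : P.IsSymm)
    (h01 : ∀ a b, P a b ∈ Set.Icc (0 : ℝ) 1) (hkl : k ≠ l)
    (hz : IsBayesEstimator P z i k l zhat) {ε : ℝ} (hε : 0 < ε) (hmax : maxEntry P ≤ 1 - ε) :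
    labelError P z i k l zhat ≤
      ε⁻¹ * ((1 / 2) * tvAffinity (bernPMF (paramVec P z k)) (bernPMF (paramVec P z l))) := by
  have hdiag : ε * tvAffinity (bernPMF (paramVecErase P z i k)) (bernPMF (paramVecErase P z i l)) ≤
      tvAffinity (bernPMF (paramVec P z k)) (bernPMF (paramVec P z l)) :=
    mul_tvAffinity_restrict_ne_le (fun _ => h01 _ _) (fun _ => h01 _ _)
      ((le_maxEntry P _ _).trans hmax) ((le_maxEntry P _ _).trans hmax)
  rw [labelError_eq_half_tvAffinity hP h01 hkl hz, inv_mul_eq_div, le_div_iff₀ hε]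
  linarith

end Bayes

/-! ### Local bounds for binomial weights -/

theorem card_filter_abs_natCast_sub_le (S : Finset ℕ) (a : ℝ) {b : ℝ} (hb : 0 ≤ b) :
    (#{y ∈ S | |((y : ℕ) : ℝ) - a| ≤ b} : ℝ) ≤ 2 * b + 1 := by
  have hsub : ({y ∈ S | |((y : ℕ) : ℝ) - a| ≤ b}).map Nat.castEmbedding ⊆
      Icc ⌈a - b⌉ ⌊a + b⌋ := by
    intro k hk
    obtain ⟨y, hy, rfl⟩ := mem_map.1 hk
    have := abs_le.1 (mem_filter.1 hy).2
    rw [mem_Icc, Nat.castEmbedding_apply, Int.ceil_le, Int.le_floor, Int.cast_natCast]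
    constructor <;> linarith
  have hcard := card_le_card hsub
  rw [card_map, Int.card_Icc] at hcard
  have hceil := Int.le_ceil (a - b)
  have hfloor := Int.floor_le (a + b)
  calc (#{y ∈ S | |((y : ℕ) : ℝ) - a| ≤ b} : ℝ) ≤ ((⌊a + b⌋ + 1 - ⌈a - b⌉).toNat : ℝ) := by
        exact_mod_cast hcard
    _ = max ((⌊a + b⌋ : ℝ) + 1 - ⌈a - b⌉) 0 := by
        rw [← Int.cast_natCast, Int.toNat_eq_max]; push_cast; rfl
    _ ≤ 2 * b + 1 := max_le (by linarith) (by linarith)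

/-- The mass of the binomial distribution with parameters `N` and `r` at `y`. -/
def binomWeight (N : ℕ) (r : ℝ) (y : ℕ) : ℝ := N.choose y * r ^ y * (1 - r) ^ (N - y)

theorem sum_bernPMF_const {ι : Type*} [Fintype ι] [DecidableEq ι] (r : ℝ) (G : ℕ → ℝ) :
    ∑ x : ι → Bool, bernPMF (fun _ => r) x * G (#{j | x j = true}) =
      ∑ y ∈ range (Fintype.card ι + 1), binomWeight (Fintype.card ι) r y * G y := by
  let e : (ι → Bool) ≃ Finset ι :=
    { toFun := fun x => univ.filter fun j => x j = true
      invFun := fun s j => decide (j ∈ s)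
      left_inv := fun x => by ext j; simp
      right_inv := fun s => by ext j; simp }
  have hmass (x : ι → Bool) : bernPMF (fun _ => r) x =
      r ^ #{j | x j = true} * (1 - r) ^ (Fintype.card ι - #{j | x j = true}) := by
    rw [bernPMF, prod_ite, prod_const, prod_const, filter_not,
      card_sdiff_of_subset (filter_subset _ _), card_univ]
  rw [Fintype.sum_equiv e _ (fun s => r ^ #s * (1 - r) ^ (Fintype.card ι - #s) * G #s)
      fun x => by rw [hmass]; rfl, ← powerset_univ,
    sum_powerset_apply_card fun m => r ^ m * (1 - r) ^ (Fintype.card ι - m) * G m, card_univ]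
  refine sum_congr rfl fun y _ => ?_
  rw [nsmul_eq_mul, binomWeight]
  ring

section Binomial

variable {N : ℕ} {r s T : ℝ} {y : ℕ}

theorem binomWeight_eq_eval (N : ℕ) (r : ℝ) (y : ℕ) :
    binomWeight N r y = (bernsteinPolynomial ℝ N y).eval r := by
  simp [bernsteinPolynomial, binomWeight]

theorem binomWeight_nonneg (hr : r ∈ Set.Icc (0 : ℝ) 1) (y : ℕ) : 0 ≤ binomWeight N r y :=
  mul_nonneg (mul_nonneg (Nat.cast_nonneg _) (pow_nonneg hr.1 _)) (pow_nonneg (sub_nonneg.2 hr.2) _)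

theorem sum_binomWeight (N : ℕ) (r : ℝ) : ∑ y ∈ range (N + 1), binomWeight N r y = 1 := by
  simp only [binomWeight_eq_eval, ← Polynomial.eval_finsetSum, bernsteinPolynomial.sum,
    Polynomial.eval_one]

theorem sum_binomWeight_mul_sq (N : ℕ) (r : ℝ) :
    ∑ y ∈ range (N + 1), binomWeight N r y * ((y : ℝ) - N * r) ^ 2 = N * r * (1 - r) := by
  have h := congrArg (Polynomial.eval r) (bernsteinPolynomial.variance ℝ N)
  simp only [Polynomial.eval_finsetSum, Polynomial.eval_mul, Polynomial.eval_pow,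
    Polynomial.eval_sub, Polynomial.eval_X, Polynomial.eval_natCast,
    Polynomial.eval_one, nsmul_eq_mul, ← binomWeight_eq_eval] at h
  rw [← h]
  exact sum_congr rfl fun y _ => by ring

theorem sum_binomWeight_le_one (hr : r ∈ Set.Icc (0 : ℝ) 1) (S : Finset ℕ) :
    ∑ y ∈ S, binomWeight N r y ≤ 1 := by
  rw [← sum_binomWeight N r, ← sum_subset (inter_subset_left (s₁ := S) (s₂ := range (N + 1)))]
  · exact sum_le_sum_of_subset_of_nonneg inter_subset_right fun y _ _ => binomWeight_nonneg hr y
  · intro y hyS hy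
    rw [mem_inter, not_and, mem_range, not_lt] at hy
    simp [binomWeight, Nat.choose_eq_zero_of_lt (hy hyS)]

theorem binomWeight_succ (N : ℕ) (r : ℝ) (y : ℕ) :
    (y + 1) * (1 - r) * binomWeight N r (y + 1) = (N - y) * r * binomWeight N r y := by
  unfold binomWeight
  rcases lt_or_ge y N with h | h
  · have hchoose := congrArg (Nat.cast (R := ℝ)) (Nat.choose_succ_right_eq N y)
    push_cast [Nat.cast_sub h.le] at hchoose
    rw [show N - y = N - (y + 1) + 1 by omega, pow_succ, pow_succ]
    linear_combination r ^ y * r * (1 - r) ^ (N - (y + 1)) * (1 - r) * hchoose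
  · rw [Nat.choose_eq_zero_of_lt (Nat.lt_succ_of_le h)]
    rcases h.eq_or_lt with rfl | h
    · simp
    · simp [Nat.choose_eq_zero_of_lt h]

theorem binomWeight_le_succ (hr : r ∈ Set.Ico (0 : ℝ) 1) (h : (y : ℝ) + 1 ≤ (N + 1) * r) :
    binomWeight N r y ≤ binomWeight N r (y + 1) := by
  have hpos : 0 < (y + 1) * (1 - r) := mul_pos (by positivity) (sub_pos.2 hr.2)
  refine le_of_mul_le_mul_left ?_ hpos
  rw [binomWeight_succ]
  exact mul_le_mul_of_nonneg_right (by linarith) (binomWeight_nonneg ⟨hr.1, hr.2.le⟩ y)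

theorem binomWeight_succ_le (hr : r ∈ Set.Ico (0 : ℝ) 1) (h : (N + 1) * r ≤ (y : ℝ) + 1) :
    binomWeight N r (y + 1) ≤ binomWeight N r y := by
  have hpos : 0 < (y + 1) * (1 - r) := mul_pos (by positivity) (sub_pos.2 hr.2)
  refine le_of_mul_le_mul_left ?_ hpos
  rw [binomWeight_succ]
  exact mul_le_mul_of_nonneg_right (by linarith) (binomWeight_nonneg ⟨hr.1, hr.2.le⟩ y)

theorem le_exp_two_mul_mul_of_mul_eq {a c w w' δ : ℝ} (ha : 0 < a) (hw : 0 ≤ w) (h0 : 0 ≤ δ)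
    (h1 : δ ≤ 1 / 2) (h : a * w' = c * w) (hac : (1 - δ) * a ≤ c) : w ≤ exp (2 * δ) * w' := by
  have hexp : 1 ≤ exp (2 * δ) * (1 - δ) := by nlinarith [add_one_le_exp (2 * δ)]
  have hle : (1 - δ) * w ≤ w' := by
    refine le_of_mul_le_mul_left ?_ ha
    rw [h, ← mul_assoc, mul_comm a]
    exact mul_le_mul_of_nonneg_right hac hw
  calc w ≤ exp (2 * δ) * (1 - δ) * w := le_mul_of_one_le_left hw hexp
    _ = exp (2 * δ) * ((1 - δ) * w) := mul_assoc ..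
    _ ≤ exp (2 * δ) * w' := mul_le_mul_of_nonneg_left hle (exp_nonneg _)

theorem binomWeight_le_exp_mul_succ (hr : r ∈ Set.Ioo (0 : ℝ) 1) (hs : 0 < s)
    (hV : s ^ 2 = N * r * (1 - r)) (hTs : 4 * T ≤ s)
    (h1 : |(y : ℝ) - N * r| ≤ T * s) (h2 : |((y + 1 : ℕ) : ℝ) - N * r| ≤ T * s) :
    binomWeight N r y ≤ exp (4 * T / s) * binomWeight N r (y + 1) ∧
      binomWeight N r (y + 1) ≤ exp (4 * T / s) * binomWeight N r y := by
  have hw := binomWeight_nonneg (N := N) ⟨hr.1.le, hr.2.le⟩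
  have hrec := binomWeight_succ N r y
  have hT : 0 ≤ T := nonneg_of_mul_nonneg_left ((abs_nonneg _).trans h1) hs
  have hδ : 2 * T / s ≤ 1 / 2 := by rw [div_le_iff₀ hs]; linarith
  have hδs : 2 * T / s * (s ^ 2 / 2) = T * s := by field_simp
  have hTs2 : 4 * (T * s) ≤ s ^ 2 := by nlinarith
  rw [abs_le] at h1 h2
  push_cast at h2
  have hup : s ^ 2 / 2 ≤ (y + 1) * (1 - r) := by nlinarith [hr.1, hr.2]
  have hdown : s ^ 2 / 2 ≤ (N - y) * r := by nlinarith [hr.1, hr.2]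
  have hs2 : 0 < s ^ 2 / 2 := by positivity
  have hδ0 : 0 ≤ 2 * T / s := by positivity
  rw [show 4 * T / s = 2 * (2 * T / s) by ring]
  constructor
  · refine le_exp_two_mul_mul_of_mul_eq (hs2.trans_le hup) (hw y) hδ0 hδ hrec ?_
    linarith [mul_le_mul_of_nonneg_left hup hδ0, hr.1]
  · refine le_exp_two_mul_mul_of_mul_eq (hs2.trans_le hdown) (hw _) hδ0 hδ hrec.symm ?_
    linarith [mul_le_mul_of_nonneg_left hdown hδ0, hr.2]

theorem binomWeight_le_exp_pow_mul_add (hr : r ∈ Set.Ioo (0 : ℝ) 1) (hs : 0 < s)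
    (hV : s ^ 2 = N * r * (1 - r)) (hTs : 4 * T ≤ s) {d : ℕ}
    (h1 : |(y : ℝ) - N * r| ≤ T * s) (h2 : |((y + d : ℕ) : ℝ) - N * r| ≤ T * s) :
    binomWeight N r y ≤ exp (4 * T / s) ^ d * binomWeight N r (y + d) ∧
      binomWeight N r (y + d) ≤ exp (4 * T / s) ^ d * binomWeight N r y := by
  have hwindow {x : ℕ} (hyx : y ≤ x) (hxd : x ≤ y + d) : |(x : ℝ) - N * r| ≤ T * s := by
    have hyx' : (y : ℝ) ≤ x := Nat.cast_le.2 hyx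
    have hxd' : (x : ℝ) ≤ (y + d : ℕ) := Nat.cast_le.2 hxd
    rw [abs_le] at h1 h2 ⊢
    constructor <;> linarith
  have hstep {x : ℕ} (hyx : y ≤ x) (hxd : x + 1 ≤ y + d) :=
    binomWeight_le_exp_mul_succ hr hs hV hTs (hwindow hyx (by omega)) (hwindow (by omega) hxd)
  constructor
  · have := le_geom (u := fun m => binomWeight N r (y + d - m)) (exp_nonneg (4 * T / s)) d
      fun m hm => by
        have h := (hstep (x := y + d - (m + 1)) (by omega) (by omega)).1
        rwa [show y + d - (m + 1) + 1 = y + d - m by omega] at h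
    simpa using this
  · exact le_geom (u := fun m => binomWeight N r (y + m)) (exp_nonneg _) d fun m hm =>
      (hstep (Nat.le_add_right y m) (by omega)).2

theorem binomWeight_le_exp_mul_binomWeight (hr : r ∈ Set.Ioo (0 : ℝ) 1) (hs : 0 < s)
    (hV : s ^ 2 = N * r * (1 - r)) (hTs : 4 * T ≤ s) {y y' : ℕ}
    (h1 : |(y : ℝ) - N * r| ≤ T * s) (h2 : |(y' : ℝ) - N * r| ≤ T * s) :
    binomWeight N r y ≤ exp (8 * T ^ 2) * binomWeight N r y' := by
  have hT : 0 ≤ T := nonneg_of_mul_nonneg_left ((abs_nonneg _).trans h1) hs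
  have hw := binomWeight_nonneg (N := N) ⟨hr.1.le, hr.2.le⟩
  have hpow {d : ℕ} (hd : (d : ℝ) ≤ 2 * (T * s)) : exp (4 * T / s) ^ d ≤ exp (8 * T ^ 2) := by
    rw [← exp_nat_mul, exp_le_exp]
    calc d * (4 * T / s) ≤ 2 * (T * s) * (4 * T / s) := by gcongr
      _ = 8 * T ^ 2 := by field_simp; ring
  have h1' := abs_le.1 h1
  have h2' := abs_le.1 h2
  rcases le_total y y' with h | h <;> obtain ⟨d, rfl⟩ := Nat.exists_eq_add_of_le h
  · refine (binomWeight_le_exp_pow_mul_add hr hs hV hTs h1 h2).1.trans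
      (mul_le_mul_of_nonneg_right (hpow ?_) (hw _))
    push_cast at h2'
    linarith
  · refine (binomWeight_le_exp_pow_mul_add hr hs hV hTs h2 h1).2.trans
      (mul_le_mul_of_nonneg_right (hpow ?_) (hw _))
    push_cast at h1'
    linarith

theorem binomWeight_le_of_abs_sub_le (hr : r ∈ Set.Ioo (0 : ℝ) 1) (hV : s ^ 2 = N * r * (1 - r))
    (hs : 4 ≤ s) (hy : |(y : ℝ) - N * r| ≤ s) : binomWeight N r y ≤ 2 * exp 8 / s := by
  have hmean : 0 ≤ N * r := mul_nonneg (Nat.cast_nonneg _) hr.1.le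
  have hw := binomWeight_nonneg (N := N) ⟨hr.1.le, hr.2.le⟩
  have hwindow : ∀ i ∈ range ⌊s⌋₊,
      binomWeight N r y ≤ exp 8 * binomWeight N r (⌈N * r⌉₊ + i) := by
    intro i hi
    have hi' : ((i + 1 : ℕ) : ℝ) ≤ s := (Nat.le_floor_iff (by linarith)).1 (mem_range.1 hi)
    have := binomWeight_le_exp_mul_binomWeight (T := 1) (y := y) (y' := ⌈N * r⌉₊ + i) hr
      (by linarith) hV (by linarith) (by rwa [one_mul]) (by
        push_cast at hi' ⊢
        rw [abs_le]
        constructor <;> linarith [Nat.le_ceil (N * r), Nat.ceil_lt_add_one hmean,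
          Nat.cast_nonneg (α := ℝ) i])
    simpa using this
  have hsum : ⌊s⌋₊ * binomWeight N r y ≤ exp 8 := by
    calc ⌊s⌋₊ * binomWeight N r y
        ≤ ∑ i ∈ range ⌊s⌋₊, exp 8 * binomWeight N r (⌈N * r⌉₊ + i) := by
          simpa using card_nsmul_le_sum _ _ _ hwindow
      _ = exp 8 * ∑ m ∈ (range ⌊s⌋₊).map (addLeftEmbedding ⌈N * r⌉₊), binomWeight N r m := by
          rw [← mul_sum, sum_map]; rfl
      _ ≤ exp 8 := mul_le_of_le_one_right (exp_nonneg _)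
          (sum_binomWeight_le_one ⟨hr.1.le, hr.2.le⟩ _)
  rw [le_div_iff₀ (by linarith)]
  nlinarith [Nat.lt_floor_add_one s, hw y]

theorem binomWeight_le (hr : r ∈ Set.Ioo (0 : ℝ) 1) (hV : s ^ 2 = N * r * (1 - r)) (hs : 4 ≤ s)
    (y : ℕ) : binomWeight N r y ≤ 2 * exp 8 / s := by
  have hr' : r ∈ Set.Ico (0 : ℝ) 1 := ⟨hr.1.le, hr.2⟩
  have hmean : 0 ≤ N * r := mul_nonneg (Nat.cast_nonneg _) hr.1.le
  have hc := Nat.le_ceil (N * r)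
  have hc' := Nat.ceil_lt_add_one hmean
  rcases le_or_gt ⌈N * r⌉₊ y with h | h
  · have hanti : AntitoneOn (binomWeight N r) (Set.Ici ⌈N * r⌉₊) :=
      antitoneOn_of_succ_le Set.ordConnected_Ici fun x _ hx _ => binomWeight_succ_le hr' (by
        have : ((⌈N * r⌉₊ : ℕ) : ℝ) ≤ x := Nat.cast_le.2 hx
        linarith [hr.2])
    refine (hanti Set.self_mem_Ici h h).trans (binomWeight_le_of_abs_sub_le hr hV hs ?_)
    rw [abs_le]
    constructor <;> linarith
  · obtain ⟨m, hm⟩ : ∃ m, ⌈N * r⌉₊ = m + 1 := Nat.exists_eq_add_one.2 (by omega)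
    rw [hm] at hc hc' h
    push_cast at hc hc'
    have hmono : MonotoneOn (binomWeight N r) (Set.Iic m) :=
      monotoneOn_of_le_succ Set.ordConnected_Iic fun x _ _ hx => binomWeight_le_succ hr' (by
        have : ((x + 1 : ℕ) : ℝ) ≤ m := Nat.cast_le.2 hx
        push_cast at this
        linarith [hr.1])
    have hym : y ≤ m := by omega
    refine (hmono hym Set.self_mem_Iic hym).trans (binomWeight_le_of_abs_sub_le hr hV hs ?_)
    rw [abs_le]
    constructor <;> linarith

theorem half_le_sum_binomWeight (hr : r ∈ Set.Icc (0 : ℝ) 1) (hs : 0 < s)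
    (hV : s ^ 2 = N * r * (1 - r)) :
    1 / 2 ≤ ∑ y ∈ range (N + 1) with |((y : ℕ) : ℝ) - N * r| ≤ 2 * s, binomWeight N r y := by
  have h := sum_filter_abs_le_ge (range (N + 1)) (f := fun y : ℕ => (y : ℝ) - N * r)
    (fun y _ => binomWeight_nonneg (N := N) hr y) (T := 2 * s) (by positivity)
  rw [sum_binomWeight, sum_binomWeight_mul_sq, ← hV, mul_pow,
    div_mul_cancel_right₀ (by positivity)] at h
  norm_num at h ⊢
  linarith

theorem le_binomWeight (hr : r ∈ Set.Ioo (0 : ℝ) 1) (hV : s ^ 2 = N * r * (1 - r)) (hT : 2 ≤ T)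
    (hTs : 4 * T ≤ s) (hy : |(y : ℝ) - N * r| ≤ T * s) :
    (exp (8 * T ^ 2) * (10 * s))⁻¹ ≤ binomWeight N r y := by
  have hs : 0 < s := by linarith
  have hw := binomWeight_nonneg (N := N) ⟨hr.1.le, hr.2.le⟩
  have hcard := card_filter_abs_natCast_sub_le (range (N + 1)) (N * r) (b := 2 * s) (by positivity)
  have hsum : 1 / 2 ≤ 5 * s * (exp (8 * T ^ 2) * binomWeight N r y) := by
    refine (half_le_sum_binomWeight ⟨hr.1.le, hr.2.le⟩ hs hV).trans
      ((sum_le_card_nsmul _ _ (exp (8 * T ^ 2) * binomWeight N r y) fun y' hy' => ?_).trans ?_)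
    · exact binomWeight_le_exp_mul_binomWeight hr hs hV hTs
        ((mem_filter.1 hy').2.trans (mul_le_mul_of_nonneg_right hT hs.le)) hy
    · rw [nsmul_eq_mul]
      exact mul_le_mul_of_nonneg_right (by linarith) (mul_nonneg (exp_nonneg _) (hw y))
  rw [inv_le_iff_one_le_mul₀ (by positivity)]
  linarith

end Binomial

/-! ### Exponential moments of centred sums with a block of equal coordinates -/

theorem sum_exp_neg_mul_sub_le {a c : ℝ} (ha : 0 < a) {S : Finset ℤ} (hS : ∀ y ∈ S, c ≤ y) :
    ∑ y ∈ S, exp (-(a * (y - c))) ≤ (1 + a) / a := by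
  have hlt : exp (-a) < 1 := by simpa using ha
  have hgeom : (1 - exp (-a))⁻¹ ≤ (1 + a) / a := by
    have hexp : (exp a)⁻¹ ≤ (1 + a)⁻¹ := by
      gcongr
      linarith [add_one_le_exp a]
    have hsub : a / (1 + a) = 1 - (1 + a)⁻¹ := by field_simp; ring
    refine inv_le_of_inv_le₀ (by positivity) ?_
    rw [inv_div, exp_neg]
    linarith
  have hceil {y : ℤ} (hy : y ∈ S) : ⌈c⌉ ≤ y := Int.ceil_le.2 (hS y hy)
  have hinj : Set.InjOn (fun y : ℤ => (y - ⌈c⌉).toNat) S := fun x hx y hy hxy => by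
    have := hceil hx
    have := hceil hy
    simp only at hxy
    omega
  refine le_trans ?_ hgeom
  calc ∑ y ∈ S, exp (-(a * (y - c)))
      ≤ ∑ y ∈ S, exp (-a) ^ (y - ⌈c⌉).toNat := by
        refine sum_le_sum fun y hy => ?_
        have hcast : (((y - ⌈c⌉).toNat : ℕ) : ℝ) = y - ⌈c⌉ := by
          exact_mod_cast Int.toNat_of_nonneg (sub_nonneg.2 (hceil hy))
        rw [← exp_nat_mul, hcast, mul_neg, exp_le_exp, neg_le_neg_iff, mul_comm]
        exact mul_le_mul_of_nonneg_left (sub_le_sub_left (Int.le_ceil c) _) ha.le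
    _ = ∑ m ∈ S.image fun y => (y - ⌈c⌉).toNat, exp (-a) ^ m :=
        (sum_image (f := fun m => exp (-a) ^ m) hinj).symm
    _ ≤ (1 - exp (-a))⁻¹ :=
        sum_le_hasSum _ (fun m _ => by positivity) (hasSum_geometric_of_lt_one (exp_nonneg _) hlt)

theorem sum_exp_neg_mul_abs_sub_le {a : ℝ} (ha : 0 < a) (c : ℝ) (S : Finset ℤ) :
    ∑ y ∈ S, exp (-(a * |y - c|)) ≤ 2 * ((1 + a) / a) := by
  have hright : ∑ y ∈ S with c ≤ (y : ℤ), exp (-(a * |y - c|)) ≤ (1 + a) / a := by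
    refine le_trans (sum_le_sum fun y hy => ?_)
      (sum_exp_neg_mul_sub_le ha fun y hy => (mem_filter.1 hy).2)
    rw [abs_of_nonneg (sub_nonneg.2 (mem_filter.1 hy).2)]
  have hleft : ∑ y ∈ S with ¬ c ≤ (y : ℤ), exp (-(a * |y - c|)) ≤ (1 + a) / a := by
    have h := sum_exp_neg_mul_sub_le ha (c := -c)
      (S := ({y ∈ S | ¬ c ≤ (y : ℤ)}).map (Equiv.neg ℤ).toEmbedding) fun y hy => by
        obtain ⟨x, hx, rfl⟩ := mem_map.1 hy
        simpa using (not_le.1 (mem_filter.1 hx).2).le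
    rw [sum_map] at h
    refine le_trans (sum_le_sum fun y hy => ?_) h
    rw [abs_of_neg (sub_neg.2 (not_le.1 (mem_filter.1 hy).2))]
    simp [add_comm, sub_eq_add_neg]
  rw [← sum_filter_add_sum_filter_not S fun y : ℤ => c ≤ y, two_mul]
  exact add_le_add hright hleft

section Binomial

variable {N : ℕ} {r s lam : ℝ}

theorem abs_mul_sub_add (hlam : lam ≠ 0) (m t y : ℝ) :
    |lam * (y - m) + t| = |lam| * |y - (m - t / lam)| := by
  rw [← abs_mul]
  congr 1
  field_simp
  ring

theorem sum_binomWeight_mul_exp_neg_abs_le (hr : r ∈ Set.Ioo (0 : ℝ) 1)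
    (hV : s ^ 2 = N * r * (1 - r)) (hs : 4 ≤ s) {κ : ℝ} (hκ : 0 < κ) (hlam : lam ≠ 0) (t : ℝ) :
    ∑ y ∈ range (N + 1), binomWeight N r y * exp (-(κ * |lam * (y - N * r) + t|)) ≤
      2 * exp 8 / s * (2 * ((1 + κ * |lam|) / (κ * |lam|))) := by
  have hsum := sum_exp_neg_mul_abs_sub_le (mul_pos hκ (abs_pos.2 hlam)) (N * r - t / lam)
    ((range (N + 1)).map Nat.castEmbedding)
  simp only [sum_map, Nat.castEmbedding_apply, Int.cast_natCast] at hsum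
  calc ∑ y ∈ range (N + 1), binomWeight N r y * exp (-(κ * |lam * (y - N * r) + t|))
      ≤ ∑ y ∈ range (N + 1),
          2 * exp 8 / s * exp (-(κ * |lam| * |(y : ℝ) - (N * r - t / lam)|)) := by
        refine sum_le_sum fun y _ => ?_
        rw [abs_mul_sub_add hlam, ← mul_assoc κ]
        exact mul_le_mul_of_nonneg_right (binomWeight_le hr hV hs y) (exp_nonneg _)
    _ ≤ 2 * exp 8 / s * (2 * ((1 + κ * |lam|) / (κ * |lam|))) := by
        rw [← mul_sum]
        gcongr

theorem sum_range_shift_le_sum_range {f : ℕ → ℝ} (hf : ∀ y, 0 ≤ f y) (hN : ∀ y, N < y → f y = 0)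
    (b m : ℕ) : ∑ i ∈ range m, f (b + i) ≤ ∑ y ∈ range (N + 1), f y := by
  calc ∑ i ∈ range m, f (b + i) ≤ ∑ y ∈ range (b + m), f y := by
        rw [sum_range_add]
        exact le_add_of_nonneg_left (sum_nonneg fun y _ => hf y)
    _ ≤ ∑ y ∈ range (N + 1 + (b + m)), f y :=
        sum_le_sum_of_subset_of_nonneg (range_subset_range.2 (by omega)) fun y _ _ => hf y
    _ = ∑ y ∈ range (N + 1), f y := by
        rw [sum_range_add, sum_eq_zero (s := range (b + m)) fun y _ => hN _ (by omega), add_zero]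

theorem le_binomWeight_mul_exp_neg_abs (hr : r ∈ Set.Ioo (0 : ℝ) 1)
    (hV : s ^ 2 = N * r * (1 - r)) {τ t : ℝ} (hτ : 0 ≤ τ) (hs : 4 * (τ + 2) ≤ s)
    (hlam : 1 ≤ |lam| * s) (ht : |t / lam| ≤ τ * s) {y : ℕ}
    (hy : |y - (N * r - t / lam)| ≤ 1 + 1 / |lam|) :
    (exp (8 * (τ + 2) ^ 2) * (10 * s))⁻¹ * exp (-(|lam| + 1)) ≤
      binomWeight N r y * exp (-|lam * (y - N * r) + t|) := by
  have hs0 : 0 < s := by linarith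
  have hlam0 : 0 < |lam| := pos_of_mul_pos_left (one_pos.trans_le hlam) hs0.le
  have hinv : 1 / |lam| ≤ s := (div_le_iff₀' hlam0).2 hlam
  refine mul_le_mul (le_binomWeight hr hV (by linarith) hs ?_) ?_ (exp_nonneg _)
    (binomWeight_nonneg ⟨hr.1.le, hr.2.le⟩ _)
  · rw [abs_le] at ht hy ⊢
    constructor <;> linarith
  · rw [exp_le_exp, neg_le_neg_iff, abs_mul_sub_add (abs_pos.1 hlam0)]
    calc |lam| * |y - (N * r - t / lam)| ≤ |lam| * (1 + 1 / |lam|) := by gcongr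
      _ = |lam| + 1 := by rw [mul_add, mul_one_div_cancel hlam0.ne', mul_one]

-- The `⌈1 / |lam|⌉` integers following the zero `N r - t / lam` of the exponent each contribute
-- `≳ 1 / s`.
theorem le_sum_binomWeight_mul_exp_neg_abs (hr : r ∈ Set.Ioo (0 : ℝ) 1)
    (hV : s ^ 2 = N * r * (1 - r)) {τ t : ℝ} (hτ : 0 ≤ τ) (hs : 4 * (τ + 2) ≤ s)
    (hlam : 1 ≤ |lam| * s) (ht : |t| ≤ |lam| * (τ * s)) :
    (exp (8 * (τ + 2) ^ 2) * (10 * s))⁻¹ * exp (-(|lam| + 1)) / |lam| ≤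
      ∑ y ∈ range (N + 1), binomWeight N r y * exp (-|lam * (y - N * r) + t|) := by
  have hs0 : 0 < s := by linarith
  have hlam0 : 0 < |lam| := pos_of_mul_pos_left (one_pos.trans_le hlam) hs0.le
  have htc : |t / lam| ≤ τ * s := by rwa [abs_div, div_le_iff₀' hlam0]
  set c : ℝ := N * r - t / lam
  have hc0 : 0 ≤ c := by
    have hmean : s ^ 2 ≤ N * r := by
      rw [hV]
      exact mul_le_of_le_one_right (mul_nonneg N.cast_nonneg hr.1.le) (by linarith [hr.1])
    nlinarith [(abs_le.1 htc).2]
  have hceil := Nat.le_ceil c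
  have hceil' := Nat.ceil_lt_add_one hc0
  have hterm : ∀ i ∈ range ⌈1 / |lam|⌉₊,
      (exp (8 * (τ + 2) ^ 2) * (10 * s))⁻¹ * exp (-(|lam| + 1)) ≤
        binomWeight N r (⌈c⌉₊ + i) * exp (-|lam * ((⌈c⌉₊ + i : ℕ) - N * r) + t|) := by
    intro i hi
    have hi' : (i : ℝ) < 1 / |lam| := Nat.lt_ceil.1 (mem_range.1 hi)
    refine le_binomWeight_mul_exp_neg_abs hr hV hτ hs hlam htc ?_
    push_cast
    exact abs_le.2 ⟨by linarith, by linarith⟩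
  calc (exp (8 * (τ + 2) ^ 2) * (10 * s))⁻¹ * exp (-(|lam| + 1)) / |lam|
      ≤ ⌈1 / |lam|⌉₊ * ((exp (8 * (τ + 2) ^ 2) * (10 * s))⁻¹ * exp (-(|lam| + 1))) := by
        rw [div_eq_inv_mul _ |lam|, ← one_div]
        gcongr
        exact Nat.le_ceil _
    _ ≤ ∑ i ∈ range ⌈1 / |lam|⌉₊,
          binomWeight N r (⌈c⌉₊ + i) * exp (-|lam * ((⌈c⌉₊ + i : ℕ) - N * r) + t|) := by
        simpa using card_nsmul_le_sum _ _ _ hterm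
    _ ≤ _ := sum_range_shift_le_sum_range
        (f := fun y => binomWeight N r y * exp (-|lam * (y - N * r) + t|))
        (fun y => mul_nonneg (binomWeight_nonneg ⟨hr.1.le, hr.2.le⟩ y) (exp_nonneg _))
        (fun y hy => by simp [binomWeight, Nat.choose_eq_zero_of_lt hy]) _ _

end Binomial

section Block

variable {ι : Type*} [Fintype ι] {p c : ι → ℝ} {A : ι → Prop} [DecidablePred A] {r s lam : ℝ}

theorem centredSum_const (r lam : ℝ) (x : ι → Bool) :
    centredSum (fun _ => r) (fun _ => lam) x =
      lam * (#{j | x j = true} - Fintype.card ι * r) := by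
  simp [centredSum, ← mul_sum]

variable [DecidableEq ι]

theorem sum_bernPMF_mul_centredSum_eq_sum_binomWeight (hp : ∀ j, A j → p j = r)
    (hc : ∀ j, A j → c j = lam) (F : ℝ → ℝ) :
    ∑ x, bernPMF p x * F (centredSum p c x) =
      ∑ v : {j // ¬ A j} → Bool, bernPMF (fun j : {j // ¬ A j} => p j) v *
        ∑ y ∈ range (Fintype.card {j // A j} + 1), binomWeight (Fintype.card {j // A j}) r y *
          F (lam * (y - Fintype.card {j // A j} * r) +
            centredSum (fun j : {j // ¬ A j} => p j) (fun j => c j) v) := by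
  have hpA : (fun j : {j // A j} => p j) = fun _ => r := funext fun j => hp _ j.2
  have hcA : (fun j : {j // A j} => c j) = fun _ => lam := funext fun j => hc _ j.2
  simp only [bernPMF_eq_mul A p, centredSum_eq_add A p c, hpA, hcA]
  rw [sum_eq_sum_sum_restrict A fun u v => bernPMF (fun _ => r) u * bernPMF _ v *
    F (centredSum (fun _ => r) (fun _ => lam) u + centredSum _ _ v), sum_comm]
  refine sum_congr rfl fun v _ => ?_
  rw [← sum_bernPMF_const r fun y => F (lam * (y - Fintype.card {j // A j} * r) +
    centredSum (fun j : {j // ¬ A j} => p j) (fun j => c j) v), mul_sum]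
  refine sum_congr rfl fun u _ => ?_
  rw [centredSum_const]
  ring

theorem sum_bernPMF_mul_exp_neg_abs_centredSum_le (hp01 : ∀ j, p j ∈ Set.Icc (0 : ℝ) 1)
    (hr : r ∈ Set.Ioo (0 : ℝ) 1) (hp : ∀ j, A j → p j = r) (hc : ∀ j, A j → c j = lam)
    (hV : s ^ 2 = Fintype.card {j // A j} * r * (1 - r)) (hs : 4 ≤ s) {κ : ℝ} (hκ : 0 < κ)
    (hlam : lam ≠ 0) :
    ∑ x, bernPMF p x * exp (-(κ * |centredSum p c x|)) ≤
      2 * exp 8 / s * (2 * ((1 + κ * |lam|) / (κ * |lam|))) := by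
  rw [sum_bernPMF_mul_centredSum_eq_sum_binomWeight hp hc fun t => exp (-(κ * |t|))]
  refine (sum_le_sum fun v _ => mul_le_mul_of_nonneg_left
    (sum_binomWeight_mul_exp_neg_abs_le hr hV hs hκ hlam _)
    (bernPMF_nonneg (fun j => hp01 _) v)).trans_eq ?_
  rw [← sum_mul, sum_bernPMF, one_mul]

theorem le_sum_bernPMF_mul_exp_neg_abs_centredSum (hp01 : ∀ j, p j ∈ Set.Icc (0 : ℝ) 1)
    (hr : r ∈ Set.Ioo (0 : ℝ) 1) (hp : ∀ j, A j → p j = r) (hc : ∀ j, A j → c j = lam)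
    (hV : s ^ 2 = Fintype.card {j // A j} * r * (1 - r)) {τ : ℝ} (hτ : 0 < τ)
    (hs : 4 * (τ + 2) ≤ s) (hlam : 1 ≤ |lam| * s)
    (hvar : 2 * ∑ j, c j ^ 2 * (p j * (1 - p j)) ≤ (|lam| * (τ * s)) ^ 2) :
    1 / 2 * ((exp (8 * (τ + 2) ^ 2) * (10 * s))⁻¹ * exp (-(|lam| + 1)) / |lam|) ≤
      ∑ x, bernPMF p x * exp (-|centredSum p c x|) := by
  have hs0 : 0 < s := by linarith
  have hlam0 : 0 < |lam| := pos_of_mul_pos_left (one_pos.trans_le hlam) hs0.le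
  have hvar' : 2 * ∑ j : {j // ¬ A j}, c j ^ 2 * (p j * (1 - p j)) ≤ (|lam| * (τ * s)) ^ 2 := by
    refine le_trans ?_ hvar
    rw [← Fintype.sum_subtype_add_sum_subtype A fun j => c j ^ 2 * (p j * (1 - p j))]
    have : 0 ≤ ∑ j : {j // A j}, c j ^ 2 * (p j * (1 - p j)) := sum_nonneg fun j _ =>
      mul_nonneg (sq_nonneg _) (mul_nonneg (hp01 j).1 (sub_nonneg.2 (hp01 j).2))
    linarith
  have hcheb := half_le_sum_bernPMF_abs_centredSum_le (p := fun j : {j // ¬ A j} => p j)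
    (fun j => hp01 j) (fun j => c j) (by positivity) hvar'
  have hnonneg (v) := bernPMF_nonneg (p := fun j : {j // ¬ A j} => p j) (fun j => hp01 _) v
  rw [sum_bernPMF_mul_centredSum_eq_sum_binomWeight hp hc fun t => exp (-|t|)]
  refine (mul_le_mul_of_nonneg_right hcheb (by positivity)).trans ?_
  rw [sum_mul]
  refine (sum_le_sum fun v hv => mul_le_mul_of_nonneg_left
    (le_sum_binomWeight_mul_exp_neg_abs hr hV hτ.le hs hlam (mem_filter.1 hv).2)
    (hnonneg v)).trans ?_
  exact sum_le_sum_of_subset_of_nonneg (filter_subset _ _) fun v _ _ =>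
    mul_nonneg (hnonneg v) (sum_nonneg fun y _ =>
      mul_nonneg (binomWeight_nonneg ⟨hr.1.le, hr.2.le⟩ y) (exp_nonneg _))

end Block

/-! ### Second derivatives and critical points -/

theorem add_half_mul_sq_le_of_le_deriv2 {D : Set ℝ} (hD : Convex ℝ D) {f f' f'' : ℝ → ℝ}
    {m a x : ℝ} (hf : ∀ y ∈ D, HasDerivAt f (f' y) y) (hf' : ∀ y ∈ D, HasDerivAt f' (f'' y) y)
    (hm : ∀ y ∈ D, m ≤ f'' y) (ha : a ∈ interior D) (hcrit : f' a = 0) (hx : x ∈ D) :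
    f a + m / 2 * (x - a) ^ 2 ≤ f x := by
  let h (y : ℝ) : ℝ := f y - m / 2 * (y - a) ^ 2
  have hh (y : ℝ) (hy : y ∈ D) : HasDerivAt h (f' y - m * (y - a)) y := by
    have hsq := (((hasDerivAt_id y).sub_const a).pow 2).const_mul (m / 2)
    refine ((hf y hy).sub hsq).congr_deriv ?_
    simp
    ring
  have hh' (y : ℝ) (hy : y ∈ D) : HasDerivAt (fun y => f' y - m * (y - a)) (f'' y - m) y := by
    refine ((hf' y hy).sub (((hasDerivAt_id y).sub_const a).const_mul m)).congr_deriv ?_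
    simp
  have hsub := interior_subset (s := D)
  have hconv : ConvexOn ℝ D h := convexOn_of_hasDerivWithinAt2_nonneg hD
    (fun y hy => (hh y hy).continuousAt.continuousWithinAt)
    (fun y hy => (hh y (hsub hy)).hasDerivWithinAt)
    (fun y hy => (hh' y (hsub hy)).hasDerivWithinAt) fun y hy => sub_nonneg.2 (hm y (hsub hy))
  have hcrit' : derivWithin h (Set.Ioi a) a = 0 := by
    rw [(hh a (hsub ha)).hasDerivWithinAt.derivWithin (uniqueDiffWithinAt_Ioi a), hcrit]
    simp
  have hmin : h a ≤ h x := hconv.isMinOn_of_rightDeriv_eq_zero ha hcrit' hx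
  simp only [h, sub_self] at hmin
  linarith

-- Comparing `f 0 = f 1` with the Taylor bounds at the critical point from both sides gives
-- `ρ (1 - a) ^ 2 ≤ a ^ 2` and `ρ a ^ 2 ≤ (1 - a) ^ 2`.
theorem critical_mem_Icc_of_deriv2_mem_Icc {f f' f'' : ℝ → ℝ} {ρ M a : ℝ}
    (hf : ∀ y, HasDerivAt f (f' y) y) (hf' : ∀ y, HasDerivAt f' (f'' y) y) (hρ : 0 < ρ)
    (hM : 0 < M) (hf'' : ∀ y ∈ Set.Icc (0 : ℝ) 1, f'' y ∈ Set.Icc (ρ * M) M) (h01 : f 0 = f 1)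
    (ha : a ∈ Set.Ioo (0 : ℝ) 1) (hcrit : f' a = 0) :
    a ∈ Set.Icc (ρ / (1 + ρ)) (1 - ρ / (1 + ρ)) := by
  have hint : a ∈ interior (Set.Icc (0 : ℝ) 1) := by rwa [interior_Icc]
  have lower {x : ℝ} (hx : x ∈ Set.Icc (0 : ℝ) 1) : f a + ρ * M / 2 * (x - a) ^ 2 ≤ f x :=
    add_half_mul_sq_le_of_le_deriv2 (convex_Icc 0 1) (fun y _ => hf y) (fun y _ => hf' y)
      (fun y hy => (hf'' y hy).1) hint hcrit hx
  have upper {x : ℝ} (hx : x ∈ Set.Icc (0 : ℝ) 1) : f x ≤ f a + M / 2 * (x - a) ^ 2 := by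
    have := add_half_mul_sq_le_of_le_deriv2 (convex_Icc 0 1) (m := -M) (fun y _ => (hf y).neg)
      (fun y _ => (hf' y).neg) (fun y hy => neg_le_neg (hf'' y hy).2) hint (by simp [hcrit]) hx
    simp only [Pi.neg_apply] at this
    linarith
  have hρ1 : ρ ≤ 1 := by
    have := (hf'' 0 (by simp)).1.trans (hf'' 0 (by simp)).2
    nlinarith
  have hcmp {s t : ℝ} (ht : 0 ≤ t) (h : ρ * M / 2 * s ^ 2 ≤ M / 2 * t ^ 2) : ρ * s ≤ t := by
    have hst : ρ * s ^ 2 ≤ t ^ 2 := le_of_mul_le_mul_left (a := M / 2) (by linarith) (by positivity)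
    refine (abs_le_of_sq_le_sq' ?_ ht).2
    nlinarith [mul_nonneg hρ.le (sub_nonneg.2 hρ1), sq_nonneg s]
  have hzero : (0 : ℝ) ∈ Set.Icc (0 : ℝ) 1 := by simp
  have hone : (1 : ℝ) ∈ Set.Icc (0 : ℝ) 1 := by simp
  have hleft : ρ * (1 - a) ≤ a := hcmp ha.1.le (by linarith [lower hone, upper hzero])
  have hright : ρ * a ≤ 1 - a := hcmp (by linarith [ha.2]) (by linarith [lower hzero, upper hone])
  constructor
  · rw [div_le_iff₀ (by positivity)]
    linarith
  · rw [le_sub_comm, div_le_iff₀ (by positivity)]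
    linarith

/-! ### Exponential tilting between two product Bernoulli laws -/

/-- Weighted geometric mean `x ^ (1 - a) y ^ a`, the integrand of the Chernoff `a`-coefficient. -/
def geomMean (a x y : ℝ) : ℝ := x ^ (1 - a) * y ^ a

/-- Chernoff `a`-coefficient `∑ φ_p ^ (1 - a) φ_q ^ a` of `Bern(p)` and `Bern(q)`. -/
def bernCoeff (a p q : ℝ) : ℝ := geomMean a p q + geomMean a (1 - p) (1 - q)

/-- Parameter of the tilted Bernoulli law proportional to `φ_p ^ (1 - a) φ_q ^ a`. -/
def tilt (a p q : ℝ) : ℝ := geomMean a p q / bernCoeff a p q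

/-- Log-odds ratio of `Bern(p)` and `Bern(q)`. -/
def logOddsRatio (p q : ℝ) : ℝ := log (p * (1 - q) / (q * (1 - p)))

section GeomMean

variable {a x y : ℝ}

theorem geomMean_zero (x y : ℝ) : geomMean 0 x y = x := by simp [geomMean]

theorem geomMean_one (x y : ℝ) : geomMean 1 x y = y := by simp [geomMean]

theorem geomMean_pos (hx : 0 < x) (hy : 0 < y) : 0 < geomMean a x y := by
  unfold geomMean
  positivity

theorem geomMean_self (hx : 0 < x) : geomMean a x x = x := by
  rw [geomMean, ← rpow_add hx, sub_add_cancel, rpow_one]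

theorem geomMean_le_geomMean {x' y' : ℝ} (ha : a ∈ Set.Icc (0 : ℝ) 1) (hx : 0 ≤ x) (hy : 0 ≤ y)
    (hxx' : x ≤ x') (hyy' : y ≤ y') : geomMean a x y ≤ geomMean a x' y' :=
  mul_le_mul (rpow_le_rpow hx hxx' (sub_nonneg.2 ha.2)) (rpow_le_rpow hy hyy' ha.1)
    (rpow_nonneg hy _) (rpow_nonneg (hx.trans hxx') _)

theorem geomMean_exp (a u v : ℝ) : geomMean a (exp u) (exp v) = exp ((1 - a) * u + a * v) := by
  rw [geomMean, ← exp_mul, ← exp_mul, ← exp_add, mul_comm u, mul_comm v]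

theorem hasDerivAt_geomMean (hx : 0 < x) (hy : 0 < y) (a : ℝ) :
    HasDerivAt (fun a => geomMean a x y) (geomMean a x y * log (y / x)) a := by
  have hpow := (hasDerivAt_id a).const_sub 1 |>.const_rpow (a := x) hx
  refine (hpow.mul ((hasDerivAt_id a).const_rpow hy)).congr_deriv ?_
  rw [log_div hy.ne' hx.ne', geomMean]
  simp only [id]
  ring

theorem geomMean_prod {ι : Type*} (s : Finset ι) {f g : ι → ℝ} (hf : ∀ j ∈ s, 0 ≤ f j)
    (hg : ∀ j ∈ s, 0 ≤ g j) :
    geomMean a (∏ j ∈ s, f j) (∏ j ∈ s, g j) = ∏ j ∈ s, geomMean a (f j) (g j) := by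
  simp only [geomMean, prod_mul_distrib, finsetProd_rpow _ _ hf, finsetProd_rpow _ _ hg]

theorem geomMean_mul_exp_neg_abs_log_le_min (hx : 0 < x) (hy : 0 < y)
    (ha : a ∈ Set.Icc (0 : ℝ) 1) : geomMean a x y * exp (-|log (x / y)|) ≤ min x y := by
  rw [log_div hx.ne' hy.ne', ← exp_log hx, ← exp_log hy, geomMean_exp,
    ← exp_monotone.map_min, ← exp_add, exp_le_exp, log_exp, log_exp]
  have h := abs_nonneg (log x - log y)
  have h' := le_abs_self (log x - log y)
  have h'' := neg_abs_le (log x - log y)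
  refine le_min ?_ ?_ <;> nlinarith [ha.1, ha.2]

theorem min_le_geomMean_mul_exp_neg_abs_log {κ : ℝ} (hx : 0 < x) (hy : 0 < y)
    (ha : a ∈ Set.Icc κ (1 - κ)) : min x y ≤ geomMean a x y * exp (-(κ * |log (x / y)|)) := by
  rw [log_div hx.ne' hy.ne', ← exp_log hx, ← exp_log hy, geomMean_exp,
    ← exp_monotone.map_min, ← exp_add, exp_le_exp, log_exp, log_exp]
  rcases le_total (log x) (log y) with h | h
  · rw [min_eq_left h, abs_of_nonpos (sub_nonpos.2 h)]
    nlinarith [mul_nonneg (sub_nonneg.2 ha.1) (sub_nonneg.2 h)]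
  · rw [min_eq_right h, abs_of_nonneg (sub_nonneg.2 h)]
    nlinarith [mul_nonneg (sub_nonneg.2 ha.2) (sub_nonneg.2 h)]

end GeomMean

section Tilt

variable {p q : ℝ}

theorem bernCoeff_pos (hp : p ∈ Set.Ioo (0 : ℝ) 1) (hq : q ∈ Set.Ioo (0 : ℝ) 1) (a : ℝ) :
    0 < bernCoeff a p q :=
  add_pos (geomMean_pos hp.1 hq.1) (geomMean_pos (sub_pos.2 hp.2) (sub_pos.2 hq.2))

theorem one_sub_tilt (hp : p ∈ Set.Ioo (0 : ℝ) 1) (hq : q ∈ Set.Ioo (0 : ℝ) 1) (a : ℝ) :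
    1 - tilt a p q = geomMean a (1 - p) (1 - q) / bernCoeff a p q := by
  rw [tilt, one_sub_div (bernCoeff_pos hp hq a).ne', bernCoeff, add_sub_cancel_left]

theorem tilt_mem_Ioo (hp : p ∈ Set.Ioo (0 : ℝ) 1) (hq : q ∈ Set.Ioo (0 : ℝ) 1) (a : ℝ) :
    tilt a p q ∈ Set.Ioo (0 : ℝ) 1 := by
  refine ⟨div_pos (geomMean_pos hp.1 hq.1) (bernCoeff_pos hp hq a), sub_pos.1 ?_⟩
  rw [one_sub_tilt hp hq]
  exact div_pos (geomMean_pos (sub_pos.2 hp.2) (sub_pos.2 hq.2)) (bernCoeff_pos hp hq a)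

theorem tilt_mem_Icc {a b₀ b₁ : ℝ} (ha : a ∈ Set.Icc (0 : ℝ) 1) (hb₀ : 0 < b₀) (hb₁ : b₁ < 1)
    (hp : p ∈ Set.Icc b₀ b₁) (hq : q ∈ Set.Icc b₀ b₁) : tilt a p q ∈ Set.Icc b₀ b₁ := by
  have hp0 : 0 < p := hb₀.trans_le hp.1
  have hq0 : 0 < q := hb₀.trans_le hq.1
  have hp1 : 0 < 1 - p := by linarith [hp.2]
  have hq1 : 0 < 1 - q := by linarith [hq.2]
  have hb₀1 : 0 < 1 - b₀ := by linarith [hp.1, hp.2]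
  have hb₁0 : 0 < b₁ := by linarith [hp.1, hp.2]
  have hpos := bernCoeff_pos (p := p) (q := q) ⟨hp0, by linarith⟩ ⟨hq0, by linarith⟩ a
  have hlow : b₀ ≤ geomMean a p q :=
    (geomMean_self hb₀).symm.trans_le (geomMean_le_geomMean ha hb₀.le hb₀.le hp.1 hq.1)
  have hlow' : geomMean a (1 - p) (1 - q) ≤ 1 - b₀ :=
    (geomMean_le_geomMean ha hp1.le hq1.le (by linarith [hp.1]) (by linarith [hq.1])).trans_eq
      (geomMean_self hb₀1)
  have hup : geomMean a p q ≤ b₁ :=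
    (geomMean_le_geomMean ha hp0.le hq0.le hp.2 hq.2).trans_eq (geomMean_self hb₁0)
  have hup' : 1 - b₁ ≤ geomMean a (1 - p) (1 - q) :=
    (geomMean_self (sub_pos.2 hb₁)).symm.trans_le (geomMean_le_geomMean ha (sub_pos.2 hb₁).le
      (sub_pos.2 hb₁).le (by linarith [hp.2]) (by linarith [hq.2]))
  constructor
  · rw [tilt, le_div_iff₀ hpos, bernCoeff]
    nlinarith
  · rw [tilt, div_le_iff₀ hpos, bernCoeff]
    nlinarith

theorem logOddsRatio_eq (hp : p ∈ Set.Ioo (0 : ℝ) 1) (hq : q ∈ Set.Ioo (0 : ℝ) 1) :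
    logOddsRatio p q = log (p / q) - log ((1 - p) / (1 - q)) := by
  have hp1 : 1 - p ≠ 0 := (sub_pos.2 hp.2).ne'
  have hq1 : 1 - q ≠ 0 := (sub_pos.2 hq.2).ne'
  rw [logOddsRatio, ← log_div (div_ne_zero hp.1.ne' hq.1.ne') (div_ne_zero hp1 hq1)]
  congr 1
  field_simp

theorem abs_logOddsRatio_le {b ω ε : ℝ} (hb : 0 < b) (hω : 0 < ω) (hε : 0 < ε) (hbε : b ≤ 1 - ε)
    (hp : p ∈ Set.Icc (b / ω) b) (hq : q ∈ Set.Icc (b / ω) b) : |logOddsRatio p q| ≤ ω / ε := by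
  have hle {x y : ℝ} (hx : x ∈ Set.Icc (b / ω) b) (hy : y ∈ Set.Icc (b / ω) b) :
      logOddsRatio x y ≤ ω / ε := by
    have hx0 : 0 < x := (div_pos hb hω).trans_le hx.1
    have hy0 : 0 < y := (div_pos hb hω).trans_le hy.1
    have hx1 : ε ≤ 1 - x := by linarith [hx.2]
    have hy1 : ε ≤ 1 - y := by linarith [hy.2]
    have hxy : x ≤ ω * y := hx.2.trans ((div_le_iff₀' hω).1 hy.1)
    refine (log_le_self (by have := hε.trans_le hx1; have := hε.trans_le hy1; positivity)).trans ?_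
    rw [div_le_div_iff₀ (mul_pos hy0 (hε.trans_le hx1)) hε]
    calc x * (1 - y) * ε ≤ ω * y * 1 * (1 - x) := by
          gcongr <;> linarith
      _ = ω * (y * (1 - x)) := by ring
  refine abs_le'.2 ⟨hle hp hq, ?_⟩
  rw [logOddsRatio, ← log_inv, inv_div]
  exact hle hq hp

theorem hasDerivAt_bernCoeff (hp : p ∈ Set.Ioo (0 : ℝ) 1) (hq : q ∈ Set.Ioo (0 : ℝ) 1) (a : ℝ) :
    HasDerivAt (fun a => bernCoeff a p q) (geomMean a p q * log (q / p) +
      geomMean a (1 - p) (1 - q) * log ((1 - q) / (1 - p))) a :=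
  (hasDerivAt_geomMean hp.1 hq.1 a).add (hasDerivAt_geomMean (sub_pos.2 hp.2) (sub_pos.2 hq.2) a)

theorem hasDerivAt_log_bernCoeff (hp : p ∈ Set.Ioo (0 : ℝ) 1) (hq : q ∈ Set.Ioo (0 : ℝ) 1)
    (a : ℝ) : HasDerivAt (fun a => log (bernCoeff a p q))
      (-(log ((1 - p) / (1 - q)) + logOddsRatio p q * tilt a p q)) a := by
  have hpos := (bernCoeff_pos hp hq a).ne'
  refine ((hasDerivAt_bernCoeff hp hq a).log hpos).congr_deriv ?_
  rw [add_div, mul_div_right_comm, mul_div_right_comm, ← tilt, ← one_sub_tilt hp hq,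
    logOddsRatio_eq hp hq, ← inv_div p q, ← inv_div (1 - p), log_inv, log_inv]
  ring

theorem hasDerivAt_tilt (hp : p ∈ Set.Ioo (0 : ℝ) 1) (hq : q ∈ Set.Ioo (0 : ℝ) 1) (a : ℝ) :
    HasDerivAt (fun a => tilt a p q)
      (-(logOddsRatio p q * (tilt a p q * (1 - tilt a p q)))) a := by
  have hpos := (bernCoeff_pos hp hq a).ne'
  refine ((hasDerivAt_geomMean hp.1 hq.1 a).div (hasDerivAt_bernCoeff hp hq a) hpos).congr_deriv ?_
  rw [one_sub_tilt hp hq, tilt, logOddsRatio_eq hp hq, ← inv_div p q, ← inv_div (1 - p), log_inv,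
    log_inv]
  field_simp
  rw [bernCoeff]
  ring

end Tilt

section ProductTilt

variable {ι : Type*} [Fintype ι] {p q : ι → ℝ}

/-- Logarithm of the Chernoff `a`-coefficient of `⨂ⱼ Bern(pⱼ)` and `⨂ⱼ Bern(qⱼ)`. -/
def logCoeff (p q : ι → ℝ) (a : ℝ) : ℝ := ∑ j, log (bernCoeff a (p j) (q j))

/-- Parameters of the tilted product law proportional to `φ_p ^ (1 - a) φ_q ^ a`. -/
def tiltVec (p q : ι → ℝ) (a : ℝ) : ι → ℝ := fun j => tilt a (p j) (q j)

/-- Coordinatewise log-odds ratios, the coefficients of `log (φ_p / φ_q)`. -/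
def logOddsVec (p q : ι → ℝ) : ι → ℝ := fun j => logOddsRatio (p j) (q j)

/-- Mean of `log (φ_p / φ_q)` under the tilted product law. -/
def tiltedMean (p q : ι → ℝ) (a : ℝ) : ℝ :=
  ∑ j, (log ((1 - p j) / (1 - q j)) + logOddsVec p q j * tiltVec p q a j)

/-- Variance of `log (φ_p / φ_q)` under the tilted product law. -/
def tiltedVariance (p q : ι → ℝ) (a : ℝ) : ℝ :=
  ∑ j, logOddsVec p q j ^ 2 * (tiltVec p q a j * (1 - tiltVec p q a j))

theorem logCoeff_zero (p q : ι → ℝ) : logCoeff p q 0 = 0 := by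
  simp [logCoeff, bernCoeff, geomMean_zero]

theorem logCoeff_one (p q : ι → ℝ) : logCoeff p q 1 = 0 := by
  simp [logCoeff, bernCoeff, geomMean_one]

variable (hp : ∀ j, p j ∈ Set.Ioo (0 : ℝ) 1) (hq : ∀ j, q j ∈ Set.Ioo (0 : ℝ) 1)
include hp hq

theorem geomMean_bernPMF (a : ℝ) (x : ι → Bool) :
    geomMean a (bernPMF p x) (bernPMF q x) = exp (logCoeff p q a) * bernPMF (tiltVec p q a) x := by
  have hfactor {f : ι → ℝ} (hf : ∀ j, f j ∈ Set.Ioo (0 : ℝ) 1) (j : ι) :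
      0 ≤ if x j then f j else 1 - f j := by
    split_ifs
    exacts [(hf j).1.le, sub_nonneg.2 (hf j).2.le]
  rw [bernPMF, bernPMF, bernPMF, geomMean_prod _ (fun j _ => hfactor hp j)
    (fun j _ => hfactor hq j), logCoeff, exp_sum, ← prod_mul_distrib]
  refine prod_congr rfl fun j _ => ?_
  have hpos := bernCoeff_pos (hp j) (hq j) a
  rw [exp_log hpos, tiltVec, one_sub_tilt (hp j) (hq j), tilt]
  split_ifs <;> rw [mul_div_cancel₀ _ hpos.ne']

theorem log_bernPMF_div_bernPMF (a : ℝ) (x : ι → Bool) :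
    log (bernPMF p x / bernPMF q x) =
      centredSum (tiltVec p q a) (logOddsVec p q) x + tiltedMean p q a := by
  have hratio (j : ι) : 0 < p j / q j ∧ 0 < (1 - p j) / (1 - q j) :=
    ⟨div_pos (hp j).1 (hq j).1, div_pos (sub_pos.2 (hp j).2) (sub_pos.2 (hq j).2)⟩
  have hprod : bernPMF p x / bernPMF q x =
      ∏ j, if x j then p j / q j else (1 - p j) / (1 - q j) := by
    rw [bernPMF, bernPMF, ← prod_div_distrib]
    exact prod_congr rfl fun j _ => by split_ifs <;> rfl
  rw [hprod, log_prod fun j _ => by split_ifs; exacts [(hratio j).1.ne', (hratio j).2.ne'],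
    centredSum, tiltedMean, ← sum_add_distrib]
  refine sum_congr rfl fun j _ => ?_
  rw [logOddsVec, logOddsRatio_eq (hp j) (hq j)]
  split_ifs <;> ring

theorem hasDerivAt_logCoeff (a : ℝ) : HasDerivAt (logCoeff p q) (-tiltedMean p q a) a := by
  rw [tiltedMean, ← sum_neg_distrib]
  exact HasDerivAt.fun_sum fun j _ => hasDerivAt_log_bernCoeff (hp j) (hq j) a

theorem hasDerivAt_tiltedMean (a : ℝ) :
    HasDerivAt (tiltedMean p q) (-tiltedVariance p q a) a := by
  rw [tiltedVariance, ← sum_neg_distrib]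
  refine HasDerivAt.fun_sum fun j _ =>
    (((hasDerivAt_tilt (hp j) (hq j) a).const_mul _).const_add _).congr_deriv ?_
  rw [logOddsVec, tiltVec]
  ring

theorem hasDerivAt_neg_tiltedMean (a : ℝ) :
    HasDerivAt (fun a => -tiltedMean p q a) (tiltedVariance p q a) a :=
  (hasDerivAt_tiltedMean hp hq a).fun_neg.congr_deriv (neg_neg _)

theorem tiltedVariance_nonneg (a : ℝ) : 0 ≤ tiltedVariance p q a :=
  sum_nonneg fun j _ =>
    have h := tilt_mem_Ioo (hp j) (hq j) a
    mul_nonneg (sq_nonneg _) (mul_nonneg h.1.le (sub_nonneg.2 h.2.le))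

theorem exists_tiltedMean_eq_zero : ∃ a ∈ Set.Ioo (0 : ℝ) 1, tiltedMean p q a = 0 := by
  obtain ⟨a, ha, hcrit⟩ := exists_hasDerivAt_eq_zero (f := logCoeff p q) one_pos
    (fun y _ => (hasDerivAt_logCoeff hp hq y).continuousAt.continuousWithinAt)
    (by rw [logCoeff_zero, logCoeff_one]) fun y _ => hasDerivAt_logCoeff hp hq y
  exact ⟨a, ha, neg_eq_zero.1 hcrit⟩

theorem logCoeff_le_logCoeff_of_tiltedMean_eq_zero {a : ℝ} (hcrit : tiltedMean p q a = 0)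
    (y : ℝ) : logCoeff p q a ≤ logCoeff p q y := by
  simpa using add_half_mul_sq_le_of_le_deriv2 convex_univ (m := 0)
    (fun y _ => hasDerivAt_logCoeff hp hq y) (fun y _ => hasDerivAt_neg_tiltedMean hp hq y)
    (fun y _ => tiltedVariance_nonneg hp hq y) (a := a) (by simp) (by simp [hcrit])
    (Set.mem_univ y)

variable [DecidableEq ι]

theorem chernoffDiv_bernPMF (a : ℝ) :
    chernoffDiv a (bernPMF p) (bernPMF q) = -logCoeff p q a := by
  have hsum : ∑ x, geomMean a (bernPMF p x) (bernPMF q x) = exp (logCoeff p q a) := by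
    simp only [geomMean_bernPMF hp hq, ← mul_sum, sum_bernPMF, mul_one]
  simp only [geomMean] at hsum
  rw [chernoffDiv, hsum, log_exp]

variable {a : ℝ} (ha : a ∈ Set.Ioo (0 : ℝ) 1) (hcrit : tiltedMean p q a = 0)
include ha hcrit

theorem chernoffInfo_bernPMF : chernoffInfo (bernPMF p) (bernPMF q) = -logCoeff p q a := by
  have hle (y : ℝ) : chernoffDiv y (bernPMF p) (bernPMF q) ≤ -logCoeff p q a := by
    rw [chernoffDiv_bernPMF hp hq]
    exact neg_le_neg (logCoeff_le_logCoeff_of_tiltedMean_eq_zero hp hq hcrit y)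
  have : Nonempty (Set.Ioo (0 : ℝ) 1) := ⟨⟨a, ha⟩⟩
  refine le_antisymm (ciSup_le fun y => hle y) ?_
  rw [← chernoffDiv_bernPMF hp hq]
  exact le_ciSup (f := fun y : Set.Ioo (0 : ℝ) 1 => chernoffDiv y (bernPMF p) (bernPMF q))
    ⟨_, Set.forall_mem_range.2 fun y => hle y⟩ ⟨a, ha⟩

theorem chernoffInfo_bernPMF_nonneg : 0 ≤ chernoffInfo (bernPMF p) (bernPMF q) := by
  rw [chernoffInfo_bernPMF hp hq ha hcrit, neg_nonneg, ← logCoeff_zero p q]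
  exact logCoeff_le_logCoeff_of_tiltedMean_eq_zero hp hq hcrit 0

theorem chernoffInfo_bernPMF_le {V : ℝ}
    (hV : ∀ y ∈ Set.Icc (0 : ℝ) 1, tiltedVariance p q y ≤ V) :
    chernoffInfo (bernPMF p) (bernPMF q) ≤ V / 2 := by
  have hV0 : 0 ≤ V := (tiltedVariance_nonneg hp hq 0).trans (hV 0 (by simp))
  have htaylor := add_half_mul_sq_le_of_le_deriv2 (convex_Icc (0 : ℝ) 1) (m := -V) (a := a) (x := 0)
    (fun y _ => (hasDerivAt_logCoeff hp hq y).fun_neg)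
    (fun y _ => (hasDerivAt_neg_tiltedMean hp hq y).fun_neg)
    (fun y hy => neg_le_neg (hV y hy)) (by rwa [interior_Icc]) (by simp [hcrit]) (by simp)
  rw [logCoeff_zero] at htaylor
  rw [chernoffInfo_bernPMF hp hq ha hcrit]
  nlinarith [pow_le_one₀ (n := 2) ha.1.le ha.2.le]

theorem exp_neg_chernoffInfo_mul_le_tvAffinity :
    exp (-chernoffInfo (bernPMF p) (bernPMF q)) * ∑ x, bernPMF (tiltVec p q a) x *
      exp (-|centredSum (tiltVec p q a) (logOddsVec p q) x|) ≤
        tvAffinity (bernPMF p) (bernPMF q) := by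
  rw [chernoffInfo_bernPMF hp hq ha hcrit, neg_neg, mul_sum]
  refine sum_le_sum fun x _ => ?_
  have h := geomMean_mul_exp_neg_abs_log_le_min (bernPMF_pos hp x) (bernPMF_pos hq x)
    (Set.Ioo_subset_Icc_self ha)
  rwa [geomMean_bernPMF hp hq, log_bernPMF_div_bernPMF hp hq a, hcrit, add_zero, mul_assoc] at h

theorem tvAffinity_le_exp_neg_chernoffInfo_mul {κ : ℝ} (hκ : a ∈ Set.Icc κ (1 - κ)) :
    tvAffinity (bernPMF p) (bernPMF q) ≤
      exp (-chernoffInfo (bernPMF p) (bernPMF q)) * ∑ x, bernPMF (tiltVec p q a) x *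
        exp (-(κ * |centredSum (tiltVec p q a) (logOddsVec p q) x|)) := by
  rw [chernoffInfo_bernPMF hp hq ha hcrit, neg_neg, mul_sum]
  refine sum_le_sum fun x _ => ?_
  have h := min_le_geomMean_mul_exp_neg_abs_log (bernPMF_pos hp x) (bernPMF_pos hq x) hκ
  rwa [geomMean_bernPMF hp hq, log_bernPMF_div_bernPMF hp hq a, hcrit, add_zero, mul_assoc] at h

end ProductTilt

/-! ### The sharp rate -/

section ComparableParameters

variable {ι : Type*} {p q : ι → ℝ} {b ε ω : ℝ}
variable (hb : 0 < b) (hω : 0 < ω) (hε : 0 < ε) (hbε : b ≤ 1 - ε)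
include hb hω hε hbε

theorem mem_Ioo_of_mem_Icc_div {t : ℝ} (ht : t ∈ Set.Icc (b / ω) b) : t ∈ Set.Ioo (0 : ℝ) 1 :=
  ⟨(div_pos hb hω).trans_le ht.1, by linarith [ht.2]⟩

theorem mul_one_sub_mem_Icc {t : ℝ} (ht : t ∈ Set.Icc (b / ω) b) :
    t * (1 - t) ∈ Set.Icc (ε / ω * b) b := by
  have ht01 := mem_Ioo_of_mem_Icc_div hb hω hε hbε ht
  constructor
  · calc ε / ω * b = b / ω * ε := by ring
      _ ≤ t * (1 - t) := mul_le_mul ht.1 (by linarith [ht.2]) hε.le ht01.1.le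
  · exact (mul_le_of_le_one_right ht01.1.le (by linarith [ht01.1])).trans ht.2

variable (hp : ∀ j, p j ∈ Set.Icc (b / ω) b) (hq : ∀ j, q j ∈ Set.Icc (b / ω) b)
include hp hq

theorem tiltVec_mem_Icc {a : ℝ} (ha : a ∈ Set.Icc (0 : ℝ) 1) (j : ι) :
    tiltVec p q a j ∈ Set.Icc (b / ω) b :=
  tilt_mem_Icc ha (div_pos hb hω) (by linarith) (hp j) (hq j)

variable [Fintype ι]

theorem tiltedVariance_mem_Icc {a : ℝ} (ha : a ∈ Set.Icc (0 : ℝ) 1) :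
    tiltedVariance p q a ∈ Set.Icc (ε / ω * (b * ∑ j, logOddsVec p q j ^ 2))
      (b * ∑ j, logOddsVec p q j ^ 2) := by
  have hmem (j : ι) := mul_one_sub_mem_Icc hb hω hε hbε (tiltVec_mem_Icc hb hω hε hbε hp hq ha j)
  rw [← mul_assoc, mul_sum, mul_sum, tiltedVariance]
  constructor <;> refine sum_le_sum fun j _ => ?_
  · rw [mul_comm]
    exact mul_le_mul_of_nonneg_left (hmem j).1 (sq_nonneg _)
  · rw [mul_comm b]
    exact mul_le_mul_of_nonneg_left (hmem j).2 (sq_nonneg _)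

theorem mem_Icc_of_tiltedMean_eq_zero {a : ℝ} (ha : a ∈ Set.Ioo (0 : ℝ) 1)
    (hcrit : tiltedMean p q a = 0) {j₀ : ι} (hj₀ : logOddsVec p q j₀ ≠ 0) :
    a ∈ Set.Icc (ε / ω / (1 + ε / ω)) (1 - ε / ω / (1 + ε / ω)) := by
  have hp01 (j : ι) := mem_Ioo_of_mem_Icc_div hb hω hε hbε (hp j)
  have hq01 (j : ι) := mem_Ioo_of_mem_Icc_div hb hω hε hbε (hq j)
  have hsum : 0 < ∑ j, logOddsVec p q j ^ 2 :=
    sum_pos' (fun j _ => sq_nonneg _) ⟨j₀, mem_univ _, by positivity⟩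
  exact critical_mem_Icc_of_deriv2_mem_Icc (hasDerivAt_logCoeff hp01 hq01)
    (hasDerivAt_neg_tiltedMean hp01 hq01) (div_pos hε hω) (mul_pos hb hsum)
    (fun y hy => tiltedVariance_mem_Icc hb hω hε hbε hp hq hy)
    (by rw [logCoeff_zero, logCoeff_one]) ha (by rw [hcrit, neg_zero])

variable {j₀ : ι} (hmax : ∀ j, |logOddsVec p q j| ≤ |logOddsVec p q j₀|)
include hmax

theorem tiltedVariance_le_of_isMax {a : ℝ} (ha : a ∈ Set.Icc (0 : ℝ) 1) :
    tiltedVariance p q a ≤ Fintype.card ι * b * logOddsVec p q j₀ ^ 2 :=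
  calc tiltedVariance p q a ≤ b * ∑ j, logOddsVec p q j ^ 2 :=
        (tiltedVariance_mem_Icc hb hω hε hbε hp hq ha).2
    _ ≤ b * ∑ _j : ι, logOddsVec p q j₀ ^ 2 :=
        mul_le_mul_of_nonneg_left (sum_le_sum fun j _ => sq_le_sq.2 (hmax j)) hb.le
    _ = Fintype.card ι * b * logOddsVec p q j₀ ^ 2 := by
        rw [sum_const, card_univ, nsmul_eq_mul]
        ring

end ComparableParameters

section Block

variable {ι : Type*} [Fintype ι] {p q : ι → ℝ} {a b c ε ω : ℝ} {j₀ : ι}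

/-- Standard deviation, under the tilted law, of the number of ones among the coordinates that have
the same pair of parameters as `j₀`. -/
def blockStd (p q : ι → ℝ) (a : ℝ) (j₀ : ι) : ℝ :=
  √(#{j | p j = p j₀ ∧ q j = q j₀} * (tiltVec p q a j₀ * (1 - tiltVec p q a j₀)))

theorem one_le_abs_mul_of_le_sq {X D lam C c₀ s : ℝ} (hX : 0 < X) (hD : 0 ≤ D)
    (hDX : D ≤ X * lam ^ 2 / 2) (hXD : X ≤ C * D ^ 2) (hC : 0 ≤ C) (hc₀ : 0 ≤ c₀)
    (hCX : C ≤ 4 * c₀ ^ 2 * X) (hs : 0 ≤ s) (hXs : c₀ * X ≤ s ^ 2) : 1 ≤ |lam| * s := by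
  have hC4 : 4 ≤ C * X * lam ^ 4 := by
    refine le_of_mul_le_mul_left ?_ hX
    calc X * 4 ≤ C * D ^ 2 * 4 := by gcongr
      _ ≤ C * (X * lam ^ 2 / 2) ^ 2 * 4 := by gcongr
      _ = X * (C * X * lam ^ 4) := by ring
  have hfour : 1 ≤ (|lam| * s) ^ 4 := by
    suffices 4 ≤ 4 * (|lam| * s) ^ 4 by linarith
    calc 4 ≤ C * X * lam ^ 4 := hC4
      _ ≤ 4 * c₀ ^ 2 * X * X * lam ^ 4 := by gcongr
      _ = 4 * lam ^ 4 * (c₀ * X) ^ 2 := by ring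
      _ ≤ 4 * lam ^ 4 * (s ^ 2) ^ 2 := by gcongr
      _ = 4 * (|lam| * s) ^ 4 := by rw [mul_pow, Even.pow_abs (by decide)]; ring
  exact (one_le_pow_iff_of_nonneg (by positivity) (by norm_num)).1 hfour

variable (hb : 0 < b) (hω : 0 < ω) (hε : 0 < ε) (hbε : b ≤ 1 - ε)
  (hp : ∀ j, p j ∈ Set.Icc (b / ω) b) (hq : ∀ j, q j ∈ Set.Icc (b / ω) b)
include hb hω hε hbε hp hq

theorem blockStd_sq (ha : a ∈ Set.Icc (0 : ℝ) 1) :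
    blockStd p q a j₀ ^ 2 = Fintype.card {j // p j = p j₀ ∧ q j = q j₀} *
      tiltVec p q a j₀ * (1 - tiltVec p q a j₀) := by
  have ht := mem_Ioo_of_mem_Icc_div hb hω hε hbε (tiltVec_mem_Icc hb hω hε hbε hp hq ha j₀)
  rw [blockStd, sq_sqrt (mul_nonneg (Nat.cast_nonneg _)
    (mul_nonneg ht.1.le (sub_nonneg.2 ht.2.le))), Fintype.card_subtype, mul_assoc]

theorem blockStd_sq_mem_Icc (ha : a ∈ Set.Icc (0 : ℝ) 1)
    (hcard : c * Fintype.card ι ≤ #{j | p j = p j₀ ∧ q j = q j₀}) :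
    blockStd p q a j₀ ^ 2 ∈
      Set.Icc (c * ε / ω * (Fintype.card ι * b)) (Fintype.card ι * b) := by
  have hmem := mul_one_sub_mem_Icc hb hω hε hbε (tiltVec_mem_Icc hb hω hε hbε hp hq ha j₀)
  rw [blockStd_sq hb hω hε hbε hp hq ha, Fintype.card_subtype, mul_assoc (Nat.cast _)]
  constructor
  · calc c * ε / ω * (Fintype.card ι * b) = c * Fintype.card ι * (ε / ω * b) := by ring
      _ ≤ _ := mul_le_mul hcard hmem.1 (by positivity) (Nat.cast_nonneg _)
  · refine mul_le_mul (mod_cast card_le_univ _) hmem.2 ?_ (Nat.cast_nonneg _)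
    exact le_trans (by positivity) hmem.1

variable [DecidableEq ι] (ha : a ∈ Set.Ioo (0 : ℝ) 1) (hcrit : tiltedMean p q a = 0)
  (hj₀ : logOddsVec p q j₀ ≠ 0)
  (hcard : c * Fintype.card ι ≤ #{j | p j = p j₀ ∧ q j = q j₀})
include ha hcrit hj₀ hcard

theorem tvAffinity_bernPMF_le_rate {κ : ℝ} (hc : 0 < c) (hκ : κ = ε / ω / (1 + ε / ω))
    (hs : 4 ≤ blockStd p q a j₀) :
    tvAffinity (bernPMF p) (bernPMF q) ≤ 4 * exp 8 * (1 + κ * (ω / ε)) / (κ * √(c * ε / ω)) *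
      ((√(Fintype.card ι * b) * |logOddsVec p q j₀|)⁻¹ *
        exp (-chernoffInfo (bernPMF p) (bernPMF q))) := by
  have hp01 (j : ι) := mem_Ioo_of_mem_Icc_div hb hω hε hbε (hp j)
  have hq01 (j : ι) := mem_Ioo_of_mem_Icc_div hb hω hε hbε (hq j)
  have haI := Set.Ioo_subset_Icc_self ha
  have ht (j : ι) := mem_Ioo_of_mem_Icc_div hb hω hε hbε
    (tiltVec_mem_Icc hb hω hε hbε hp hq haI j)
  have hκ0 : 0 < κ := hκ ▸ by positivity
  have haκ : a ∈ Set.Icc κ (1 - κ) :=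
    hκ ▸ mem_Icc_of_tiltedMean_eq_zero hb hω hε hbε hp hq ha hcrit hj₀
  have hlam : |logOddsVec p q j₀| ≤ ω / ε := abs_logOddsRatio_le hb hω hε hbε (hp j₀) (hq j₀)
  have hlam0 : |logOddsVec p q j₀| ≠ 0 := abs_ne_zero.2 hj₀
  have hm : 0 < (Fintype.card ι : ℝ) := Nat.cast_pos.2 (Fintype.card_pos_iff.2 ⟨j₀⟩)
  have hstd : √(c * ε / ω) * √(Fintype.card ι * b) ≤ blockStd p q a j₀ := by
    rw [← sqrt_mul (by positivity)]
    exact sqrt_le_iff.2 ⟨by linarith, (blockStd_sq_mem_Icc hb hω hε hbε hp hq haI hcard).1⟩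
  have hbound := sum_bernPMF_mul_exp_neg_abs_centredSum_le (c := logOddsVec p q)
    (fun j => Set.Ioo_subset_Icc_self (ht j)) (ht j₀)
    (A := fun j => p j = p j₀ ∧ q j = q j₀) (fun j hj => by rw [tiltVec, hj.1, hj.2, tiltVec])
    (fun j hj => by rw [logOddsVec, hj.1, hj.2, logOddsVec])
    (blockStd_sq hb hω hε hbε hp hq haI) hs hκ0 hj₀
  refine (tvAffinity_le_exp_neg_chernoffInfo_mul hp01 hq01 ha hcrit haκ).trans ?_
  calc _ ≤ exp (-chernoffInfo (bernPMF p) (bernPMF q)) * (2 * exp 8 /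
        (√(c * ε / ω) * √(Fintype.card ι * b)) *
          (2 * ((1 + κ * (ω / ε)) / (κ * |logOddsVec p q j₀|)))) := by
        grw [hbound]
        gcongr
    _ = _ := by
        field_simp [hlam0]
        ring

theorem rate_le_tvAffinity_bernPMF {τ : ℝ}
    (hmax : ∀ j, |logOddsVec p q j| ≤ |logOddsVec p q j₀|) (hτ : 0 < τ)
    (hcτ : 2 ≤ τ ^ 2 * (c * ε / ω)) (hs : 4 * (τ + 2) ≤ blockStd p q a j₀)
    (hlams : 1 ≤ |logOddsVec p q j₀| * blockStd p q a j₀) :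
    exp (-(8 * (τ + 2) ^ 2)) * exp (-(ω / ε + 1)) / 20 *
      ((√(Fintype.card ι * b) * |logOddsVec p q j₀|)⁻¹ *
        exp (-chernoffInfo (bernPMF p) (bernPMF q))) ≤ tvAffinity (bernPMF p) (bernPMF q) := by
  have hp01 (j : ι) := mem_Ioo_of_mem_Icc_div hb hω hε hbε (hp j)
  have hq01 (j : ι) := mem_Ioo_of_mem_Icc_div hb hω hε hbε (hq j)
  have haI := Set.Ioo_subset_Icc_self ha
  have ht (j : ι) := mem_Ioo_of_mem_Icc_div hb hω hε hbε
    (tiltVec_mem_Icc hb hω hε hbε hp hq haI j)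
  have hlam : |logOddsVec p q j₀| ≤ ω / ε := abs_logOddsRatio_le hb hω hε hbε (hp j₀) (hq j₀)
  have hlam0 : |logOddsVec p q j₀| ≠ 0 := abs_ne_zero.2 hj₀
  obtain ⟨hstd, hstd'⟩ := blockStd_sq_mem_Icc hb hω hε hbε hp hq haI hcard
  have hs0 : 0 < blockStd p q a j₀ := by linarith
  have hvar : 2 * tiltedVariance p q a ≤ (|logOddsVec p q j₀| * (τ * blockStd p q a j₀)) ^ 2 :=
    calc 2 * tiltedVariance p q a ≤ 2 * (Fintype.card ι * b * logOddsVec p q j₀ ^ 2) := by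
          grw [tiltedVariance_le_of_isMax hb hω hε hbε hp hq hmax haI]
      _ ≤ τ ^ 2 * (c * ε / ω) * (Fintype.card ι * b * logOddsVec p q j₀ ^ 2) := by gcongr
      _ = logOddsVec p q j₀ ^ 2 * τ ^ 2 * (c * ε / ω * (Fintype.card ι * b)) := by ring
      _ ≤ logOddsVec p q j₀ ^ 2 * τ ^ 2 * blockStd p q a j₀ ^ 2 := by gcongr
      _ = (|logOddsVec p q j₀| * (τ * blockStd p q a j₀)) ^ 2 := by rw [mul_pow, sq_abs]; ring
  have hbound := le_sum_bernPMF_mul_exp_neg_abs_centredSum (c := logOddsVec p q)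
    (fun j => Set.Ioo_subset_Icc_self (ht j)) (ht j₀)
    (A := fun j => p j = p j₀ ∧ q j = q j₀) (fun j hj => by rw [tiltVec, hj.1, hj.2, tiltVec])
    (fun j hj => by rw [logOddsVec, hj.1, hj.2, logOddsVec])
    (blockStd_sq hb hω hε hbε hp hq haI) hτ hs hlams hvar
  refine le_trans ?_ (exp_neg_chernoffInfo_mul_le_tvAffinity hp01 hq01 ha hcrit)
  grw [← hbound, ← hlam, ← le_sqrt_of_sq_le hstd']
  rw [exp_neg (8 * (τ + 2) ^ 2)]
  apply le_of_eq
  field_simp [hlam0]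
  ring

end Block

section AffinityRate

/-- Order of magnitude of the affinity of `⨂ⱼ Bern(pⱼ)` and `⨂ⱼ Bern(qⱼ)`, where `v` stands for the
number of coordinates times the largest parameter. -/
def affinityRate {ι : Type*} [Fintype ι] [DecidableEq ι] (v : ℝ) (p q : ι → ℝ) : ℝ :=
  (√v * ⨆ j, |logOddsVec p q j|)⁻¹ * exp (-chernoffInfo (bernPMF p) (bernPMF q))

theorem tvAffinity_bernPMF_mem_Icc_affinityRate {ι : Type*} [Fintype ι] [DecidableEq ι]
    {p q : ι → ℝ} {b c ε ω τ κ C : ℝ} (hc : 0 < c) (hε : 0 < ε) (hω : 0 < ω) (hτ : 0 < τ)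
    (hcτ : 2 ≤ τ ^ 2 * (c * ε / ω)) (hκ : κ = ε / ω / (1 + ε / ω)) (hC : 0 ≤ C)
    (hbε : b ≤ 1 - ε) (hp : ∀ j, p j ∈ Set.Icc (b / ω) b) (hq : ∀ j, q j ∈ Set.Icc (b / ω) b)
    (hcard : ∀ j, c * Fintype.card ι ≤ #{j' | p j' = p j ∧ q j' = q j})
    (hτX : (4 * (τ + 2)) ^ 2 ≤ c * ε / ω * (Fintype.card ι * b))
    (hCX : C ≤ 4 * (c * ε / ω) ^ 2 * (Fintype.card ι * b))
    (hXD : Fintype.card ι * b ≤ C * chernoffInfo (bernPMF p) (bernPMF q) ^ 2) :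
    tvAffinity (bernPMF p) (bernPMF q) ∈ Set.Icc
      (exp (-(8 * (τ + 2) ^ 2)) * exp (-(ω / ε + 1)) / 20 * affinityRate (Fintype.card ι * b) p q)
      (4 * exp 8 * (1 + κ * (ω / ε)) / (κ * √(c * ε / ω)) *
        affinityRate (Fintype.card ι * b) p q) := by
  have hX0 : 0 < Fintype.card ι * b :=
    pos_of_mul_pos_right ((pow_pos (by linarith) 2).trans_le hτX) (by positivity)
  have hb : 0 < b := pos_of_mul_pos_right hX0 (Nat.cast_nonneg _)
  have hι : Nonempty ι := by
    rw [← Fintype.card_pos_iff, ← Nat.cast_pos (α := ℝ)]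
    exact pos_of_mul_pos_left hX0 hb.le
  have hp01 (j : ι) := mem_Ioo_of_mem_Icc_div hb hω hε hbε (hp j)
  have hq01 (j : ι) := mem_Ioo_of_mem_Icc_div hb hω hε hbε (hq j)
  obtain ⟨a, ha, hcrit⟩ := exists_tiltedMean_eq_zero hp01 hq01
  obtain ⟨j₀, hj₀⟩ := exists_eq_ciSup_of_finite (f := fun j => |logOddsVec p q j|)
  have hmax (j : ι) : |logOddsVec p q j| ≤ |logOddsVec p q j₀| :=
    hj₀ ▸ le_ciSup (f := fun j => |logOddsVec p q j|) (Set.finite_range _).bddAbove j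
  have hstd := (blockStd_sq_mem_Icc hb hω hε hbε hp hq (Set.Ioo_subset_Icc_self ha) (hcard j₀)).1
  have hs : 4 * (τ + 2) ≤ blockStd p q a j₀ := le_sqrt_of_sq_le (hτX.trans hstd) |>.trans_eq
    (sqrt_sq (sqrt_nonneg _))
  have hlams : 1 ≤ |logOddsVec p q j₀| * blockStd p q a j₀ :=
    one_le_abs_mul_of_le_sq hX0 (chernoffInfo_bernPMF_nonneg hp01 hq01 ha hcrit)
      (chernoffInfo_bernPMF_le hp01 hq01 ha hcrit fun y hy =>
        tiltedVariance_le_of_isMax hb hω hε hbε hp hq hmax hy) hXD hC (by positivity) hCX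
      (sqrt_nonneg _) hstd
  have hlam0 : logOddsVec p q j₀ ≠ 0 :=
    abs_pos.1 (pos_of_mul_pos_left (one_pos.trans_le hlams) (sqrt_nonneg _))
  rw [affinityRate, ← hj₀]
  exact ⟨rate_le_tvAffinity_bernPMF hb hω hε hbε hp hq ha hcrit hlam0 (hcard j₀) hmax hτ hcτ hs
    hlams, tvAffinity_bernPMF_le_rate hb hω hε hbε hp hq ha hcrit hlam0 (hcard j₀) hc hκ
    (by linarith)⟩

theorem exists_tvAffinity_bernPMF_mem_Icc_affinityRate {c ε ω C : ℝ} (hc : 0 < c) (hε : 0 < ε)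
    (hω : 0 < ω) (hC : 0 ≤ C) :
    ∃ C₁ c₁ c₂ : ℝ, 0 < C₁ ∧ 0 < c₁ ∧ 0 < c₂ ∧
      ∀ {ι : Type*} [Fintype ι] [DecidableEq ι] {p q : ι → ℝ} {b : ℝ}, b ≤ 1 - ε →
        (∀ j, p j ∈ Set.Icc (b / ω) b) → (∀ j, q j ∈ Set.Icc (b / ω) b) →
        (∀ j, c * Fintype.card ι ≤ #{j' | p j' = p j ∧ q j' = q j}) →
        C₁ ≤ Fintype.card ι * b →
        Fintype.card ι * b ≤ C * chernoffInfo (bernPMF p) (bernPMF q) ^ 2 →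
        tvAffinity (bernPMF p) (bernPMF q) ∈ Set.Icc
          (c₁ * affinityRate (Fintype.card ι * b) p q)
          (c₂ * affinityRate (Fintype.card ι * b) p q) := by
  obtain ⟨τ, hτ⟩ : ∃ τ, τ = 2 / (c * ε / ω) + 1 := ⟨_, rfl⟩
  obtain ⟨κ, hκ⟩ : ∃ κ, κ = ε / ω / (1 + ε / ω) := ⟨_, rfl⟩
  have hτ0 : 0 < τ := hτ ▸ by positivity
  have hκ0 : 0 < κ := hκ ▸ by positivity
  have hc₀ : 0 < c * ε / ω := by positivity
  have hcτ : 2 ≤ τ ^ 2 * (c * ε / ω) := by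
    have h : τ * (c * ε / ω) = 2 + c * ε / ω := by
      rw [hτ, add_mul, div_mul_cancel₀ _ hc₀.ne', one_mul]
    nlinarith
  refine ⟨max ((4 * (τ + 2)) ^ 2 / (c * ε / ω)) (C / (4 * (c * ε / ω) ^ 2)), _, _,
    lt_max_of_lt_left (by positivity), ?_, ?_, fun hbε hp hq hcard hX hXD =>
    tvAffinity_bernPMF_mem_Icc_affinityRate hc hε hω hτ0 hcτ hκ hC hbε hp hq hcard
      ((div_le_iff₀' hc₀).1 ((le_max_left _ _).trans hX))
      ((div_le_iff₀' (by positivity)).1 ((le_max_right _ _).trans hX)) hXD⟩ <;> positivity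

end AffinityRate

section LabelErrorRate

variable {n K : ℕ} {P : Matrix (Fin K) (Fin K) ℝ} {z : Fin n → Fin K}

theorem paramVec_mem_Icc {ω : ℝ} (hω : 0 < ω) (hratio : maxEntry P ≤ ω * minEntry P) (a : Fin K)
    (j : Fin n) : paramVec P z a j ∈ Set.Icc (maxEntry P / ω) (maxEntry P) :=
  ⟨((div_le_iff₀' hω).2 hratio).trans (minEntry_le P _ _), le_maxEntry P _ _⟩

theorem classSize_le_card_paramVec_eq (k l : Fin K) (j : Fin n) :
    classSize z (z j) ≤
      #{j' | paramVec P z k j' = paramVec P z k j ∧ paramVec P z l j' = paramVec P z l j} :=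
  card_le_card <| monotone_filter_right _ fun j' _ hj' => by simp only [paramVec, hj', and_self]

theorem BlockRegular.maxEntry_le_mul_minEntry {β ε ω : ℝ} (h : BlockRegular β ε ω P z) :
    maxEntry P ≤ ω * minEntry P :=
  (div_le_iff₀ h.min_pos).1 h.ratio_le

theorem BlockRegular.mul_le_classSize {β ε ω : ℝ} (h : BlockRegular β ε ω P z) {m : ℕ}
    (hβ : 0 < β) (hK : K ≤ m) (j : Fin n) : 1 / (β * (m + 1)) * n ≤ classSize z (z j) := by
  have hK0 : (0 : ℝ) < K := Nat.cast_pos.2 (z j).pos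
  have hKm : (K : ℝ) ≤ m + 1 := by exact_mod_cast hK.trans (Nat.le_succ m)
  calc 1 / (β * (m + 1)) * (n : ℝ) ≤ 1 / (β * K) * n := by gcongr
    _ = n / (β * K) := one_div_mul_eq_div _ _
    _ ≤ classSize z (z j) := h.size_lower (z j)

end LabelErrorRate

theorem mainTheorem4_general :
    (∀ (n K : ℕ) (P : Matrix (Fin K) (Fin K) ℝ) (z : Fin n → Fin K) (i : Fin n) (k l : Fin K)
        (zhat : Matrix (Fin n) (Fin n) Bool → Fin K),
      P.IsSymm → (∀ a b, 0 ≤ P a b ∧ P a b ≤ 1) → k ≠ l → IsBayesEstimator P z i k l zhat →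
        labelError P z i k l zhat =
          (1 / 2) * tvAffinity (bernPMF (paramVecErase P z i k)) (bernPMF (paramVecErase P z i l)) ∧
        ∀ ε : ℝ, 0 < ε → maxEntry P ≤ 1 - ε →
          (1 / 2) * tvAffinity (bernPMF (paramVec P z k)) (bernPMF (paramVec P z l)) ≤
            labelError P z i k l zhat ∧
          labelError P z i k l zhat ≤
            ε⁻¹ * ((1 / 2) * tvAffinity (bernPMF (paramVec P z k)) (bernPMF (paramVec P z l)))) ∧
    (∀ c ε ω C₂ : ℝ, 0 < c → 0 < ε → 0 < ω → 0 < C₂ →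
      ∃ C₁ c₁ c₂ : ℝ, 0 < C₁ ∧ 0 < c₁ ∧ 0 < c₂ ∧
        ∀ (n K : ℕ) (P : Matrix (Fin K) (Fin K) ℝ) (z : Fin n → Fin K) (i : Fin n) (k l : Fin K)
          (zhat : Matrix (Fin n) (Fin n) Bool → Fin K),
          P.IsSymm → (∀ a b, 0 ≤ P a b ∧ P a b ≤ 1) → k ≠ l →
          (∀ j, c * n ≤ classSize z (z j)) → maxEntry P ≤ 1 - ε →
          maxEntry P ≤ ω * minEntry P → IsBayesEstimator P z i k l zhat →
          C₁ ≤ n * maxEntry P →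
          n * maxEntry P ≤
            C₂ * chernoffInfo (bernPMF (paramVec P z k)) (bernPMF (paramVec P z l)) ^ 2 →
          c₁ * errorRate P z k l ≤ labelError P z i k l zhat ∧
            labelError P z i k l zhat ≤ c₂ * errorRate P z k l) := by
  refine ⟨fun n K P z i k l zhat hP h01 hkl hz => ⟨labelError_eq_half_tvAffinity hP h01 hkl hz,
    fun ε hε hmax => ⟨half_tvAffinity_paramVec_le_labelError hP h01 hkl hz,
      labelError_le_inv_mul_half_tvAffinity_paramVec hP h01 hkl hz hε hmax⟩⟩, ?_⟩
  intro c ε ω C₂ hc hε hω hC₂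
  obtain ⟨C₁, c₁, c₂, hC₁, hc₁, hc₂, hrate⟩ :=
    exists_tvAffinity_bernPMF_mem_Icc_affinityRate hc hε hω hC₂.le
  refine ⟨C₁, c₁ / 2, ε⁻¹ * (c₂ / 2), hC₁, by positivity, by positivity, ?_⟩
  intro n K P z i k l zhat hP h01 hkl hsize hmax hratio hz hX hXD
  have haff : tvAffinity (bernPMF (paramVec P z k)) (bernPMF (paramVec P z l)) ∈
      Set.Icc (c₁ * errorRate P z k l) (c₂ * errorRate P z k l) := by
    have hrateFin := @hrate (Fin n) _ _ (paramVec P z k) (paramVec P z l) (maxEntry P)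
    rw [Fintype.card_fin] at hrateFin
    exact hrateFin hmax (paramVec_mem_Icc hω hratio k) (paramVec_mem_Icc hω hratio l)
      (fun j => (hsize j).trans (mod_cast classSize_le_card_paramVec_eq k l j)) hX hXD
  refine ⟨by linarith [haff.1, half_tvAffinity_paramVec_le_labelError hP h01 hkl hz],
    (labelError_le_inv_mul_half_tvAffinity_paramVec hP h01 hkl hz hε hmax).trans ?_⟩
  rw [mul_assoc]
  exact mul_le_mul_of_nonneg_left (by linarith [haff.2]) (by positivity)

end

theorem mainTheorem4 :
    -- The error is half the affinity of the two hypotheses on the row of node `i`; putting back the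
    -- diagonal entry changes the affinity at most by a factor in `[ε, 1]`.
    (∀ (n K : ℕ) (P : Matrix (Fin K) (Fin K) ℝ) (z : Fin n → Fin K) (i : Fin n) (k l : Fin K)
        (zhat : Matrix (Fin n) (Fin n) Bool → Fin K),
      P.IsSymm → (∀ a b, 0 ≤ P a b ∧ P a b ≤ 1) → k ≠ l → (z i = k ∨ z i = l) →
      IsBayesEstimator P z i k l zhat →
        labelError P z i k l zhat =
          (1 / 2) * tvAffinity (bernPMF (paramVecErase P z i k)) (bernPMF (paramVecErase P z i l)) ∧
        ∀ ε : ℝ, 0 < ε → maxEntry P ≤ 1 - ε →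
          (1 / 2) * tvAffinity (bernPMF (paramVec P z k)) (bernPMF (paramVec P z l)) ≤
            labelError P z i k l zhat ∧
          labelError P z i k l zhat ≤
            ε⁻¹ * ((1 / 2) * tvAffinity (bernPMF (paramVec P z k)) (bernPMF (paramVec P z l)))) ∧
    -- The sharp rate, with constants that depend on `β`, `ε`, `ω` and `Kstar` only.
    (∀ (β ε ω : ℝ) (Kstar : ℕ), 1 < β → 0 < ε → ε < 1 → 1 < ω →
      ∃ C₁ C₂ c₁ c₂ : ℝ, 0 < C₁ ∧ 0 < C₂ ∧ 0 < c₁ ∧ 0 < c₂ ∧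
        ∀ (n K : ℕ) (P : Matrix (Fin K) (Fin K) ℝ) (z : Fin n → Fin K) (i : Fin n) (k l : Fin K)
          (zhat : Matrix (Fin n) (Fin n) Bool → Fin K),
          K ≤ Kstar → P.IsSymm → (∀ a b, 0 ≤ P a b ∧ P a b ≤ 1) → k ≠ l → (z i = k ∨ z i = l) →
          BlockRegular β ε ω P z →
          IsBayesEstimator P z i k l zhat →
          C₁ ≤ n * maxEntry P →
          n * maxEntry P ≤
            C₂ * chernoffInfo (bernPMF (paramVec P z k)) (bernPMF (paramVec P z l)) ^ 2 →
          c₁ * errorRate P z k l ≤ labelError P z i k l zhat ∧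
            labelError P z i k l zhat ≤ c₂ * errorRate P z k l) := by
  refine ⟨fun n K P z i k l zhat hP h01 hkl _ =>
    mainTheorem4_general.1 n K P z i k l zhat hP h01 hkl, fun β ε ω Kstar hβ hε _ hω => ?_⟩
  obtain ⟨C₁, c₁, c₂, hC₁, hc₁, hc₂, hrate⟩ := mainTheorem4_general.2
    (1 / (β * (Kstar + 1))) ε ω 1 (by positivity) hε (by positivity) one_pos
  exact ⟨C₁, 1, c₁, c₂, hC₁, one_pos, hc₁, hc₂, fun n K P z i k l zhat hK hP h01 hkl _ hreg =>
    hrate n K P z i k l zhat hP h01 hkl (hreg.mul_le_classSize (by positivity) hK) hreg.max_le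
      hreg.maxEntry_le_mul_minEntry⟩
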